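/- Let $Q_d=\{0,1\}^d$. A $k$-dimensional subcube of $Q_d$ is a subset obtained by fixing $d-k$ coordinates and letting the other $k$ vary freely. Fix $\alpha\in(0,1)$ and an integer $s\ge 1$, and put $k(d)=\lfloor \alpha d\rfloor$. For each $d$, assign to the vertices $1,2,3,\dots$ independent uniformly random $k(d)$-dimensional subcubes $f(1),f(2),f(3),\dots$ of $Q_d$, and let $U_n$ be the graph on $\{1,\dots,n\}$ in which distinct $u,v$ are adjacent if and only if $f(u)\cap f(v)\neq\emptyset$ (the uniform model $G_{[n],d,k(d)}$). Let $N_s(d)$ be the least $n$ such that $U_n$ contains a clique on $s$ vertices. A real number $t\ge 0$ is called the threshold for the appearance of $s$-cliques if $\frac1d\log N_s(d)\to t$ in probability as $d\to\infty$. **Theorem.** The function $$\alpha_s(p)=\frac{p\left(2\left(\frac{1+p}{2}\right)^{s-1}-p^{s-1}\right)}{2\left(\frac{1+p}{2}\right)^{s}-p^{s}}$$ is a bijection from $(0,1)$ to itself. Let $p=\alpha_s^{-1}(\alpha)\in(0,1)$ and let $$t_{K_s}(p)=\log\frac{2}{1+p}-\frac1s\log\left(2-\left(\frac{2p}{1+p}\right)^s\right).$$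 Then the threshold for the appearance of $s$-cliques in the uniform model $G_{[n],d,\lfloor\alpha d\rfloor}$ is $$T_{K_s}(\alpha)=t_{K_s}(p)+\alpha\log\frac{p}{\alpha}+(1-\alpha)\log\frac{1-p}{1-\alpha}.$$ -/

import Mathlib

open MeasureTheory Filter Topology

/-- The intersection graph of a feature system `(V, Ω, f)`: distinct vertices are adjacent when
their feature sets meet. -/
def intersectionGraph {V Ω : Type*} (f : V → Set Ω) : SimpleGraph V where
  Adj u v := u ≠ v ∧ (f u ∩ f v).Nonempty
  symm := ⟨fun u v h => ⟨h.1.symm, by rw [Set.inter_comm]; exact h.2⟩⟩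
  loopless := ⟨fun _ h => h.1 rfl⟩

/-- Subcubes of the hypercube `Q_d = {0,1}^d`, as elements of `{0,1,⋆}^d`: the value `none` is the
wildcard `⋆` (a free coordinate), the value `some b` is a coordinate fixed to `b`. -/
abbrev Subcube (d : ℕ) : Type := Fin d → Option Bool

/-- The three symbols `0`, `1`, `⋆` carry the discrete σ-algebra, and hence so does `{0,1,⋆}^d`. -/
instance : MeasurableSpace (Option Bool) := ⊤

instance : DiscreteMeasurableSpace (Option Bool) := ⟨fun _ => trivial⟩

/-- The set of points of the hypercube `Q_d` that lie in the subcube `c`. -/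
def Subcube.points {d : ℕ} (c : Subcube d) : Set (Fin d → Bool) :=
  {x | ∀ i b, c i = some b → x i = b}

/-- The dimension of a subcube: its number of free coordinates. -/
def Subcube.dim {d : ℕ} (c : Subcube d) : ℕ :=
  (Finset.univ.filter fun i => c i = none).card

/-- The finite set of all `k`-dimensional subcubes of `Q_d`. -/
def subcubesOfDim (d k : ℕ) : Finset (Subcube d) :=
  Finset.univ.filter fun c => c.dim = k

theorem subcubesOfDim_nonempty {d k : ℕ} (hk : k ≤ d) : (subcubesOfDim d k).Nonempty := by
  refine ⟨fun i : Fin d => if (i : ℕ) < k then none else some false, ?_⟩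
  rw [subcubesOfDim, Finset.mem_filter]
  simp [Subcube.dim, Fin.card_filter_val_lt, hk]

/-- The law of a uniformly random `k`-dimensional subcube of `Q_d`. -/
noncomputable def uniformSubcubeLaw {d k : ℕ} (hk : k ≤ d) : Measure (Subcube d) :=
  (PMF.uniformOfFinset (subcubesOfDim d k) (subcubesOfDim_nonempty hk)).toMeasure

instance {d k : ℕ} (hk : k ≤ d) : IsProbabilityMeasure (uniformSubcubeLaw hk) :=
  inferInstanceAs (IsProbabilityMeasure (PMF.toMeasure _))

/-- The law of the sequence of feature subcubes `f(0), f(1), f(2), …` of the uniform model: the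
vertices independently receive uniformly random `k`-dimensional subcubes of `Q_d`. -/
noncomputable def uniformModel {d k : ℕ} (hk : k ≤ d) : Measure (ℕ → Subcube d) :=
  Measure.infinitePi fun _ : ℕ => uniformSubcubeLaw hk

/-- The subcube intersection graph on the first `n` vertices (indexed by `0, …, n - 1`) of a
sequence of feature subcubes. These graphs are nested as `n` grows. -/
def subcubeGraph {d : ℕ} (f : ℕ → Subcube d) (n : ℕ) : SimpleGraph (Fin n) :=
  intersectionGraph fun v : Fin n => (f v).points

/-- The hitting time of a graph property `P` that is closed under the addition of vertices, for the
nested sequence of subcube intersection graphs given by `f`. -/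
noncomputable def hittingTime (P : ∀ n : ℕ, SimpleGraph (Fin n) → Prop) {d : ℕ}
    (f : ℕ → Subcube d) : ℕ :=
  sInf {n | P n (subcubeGraph f n)}

theorem floor_mul_le {α : ℝ} (hα : α ∈ Set.Icc (0 : ℝ) 1) (d : ℕ) : ⌊α * d⌋₊ ≤ d :=
  Nat.floor_le_of_le (mul_le_of_le_one_left (Nat.cast_nonneg d) hα.2)

/-- `t ≥ 0` is a threshold for `P` in the uniform model with parameter `k(d) = ⌊α d⌋`: the
normalised logarithm of the hitting time converges to `t` in probability as `d → ∞`. -/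
def IsUniformThreshold (P : ∀ n : ℕ, SimpleGraph (Fin n) → Prop) {α : ℝ}
    (hα : α ∈ Set.Icc (0 : ℝ) 1) (t : ℝ) : Prop :=
  0 ≤ t ∧ ∀ ε : ℝ, 0 < ε →
    Tendsto
      (fun d : ℕ => uniformModel (floor_mul_le hα d)
        {f | ε ≤ |Real.log (hittingTime P f) / d - t|})
      atTop (𝓝 0)

/-- The property of containing a clique on `s` vertices. -/
def ContainsClique (s : ℕ) (n : ℕ) (G : SimpleGraph (Fin n)) : Prop :=
  ∃ S : Finset (Fin n), G.IsNClique s S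

/-- The function `α_s(p)`. -/
noncomputable def alphaS (s : ℕ) (p : ℝ) : ℝ :=
  p * (2 * ((1 + p) / 2) ^ (s - 1) - p ^ (s - 1)) / (2 * ((1 + p) / 2) ^ s - p ^ s)

/-- The quantity `t_{K_s}(p)`, the `s`-clique threshold of the binomial model. -/
noncomputable def cliqueExponent (s : ℕ) (p : ℝ) : ℝ :=
  Real.log (2 / (1 + p)) - 1 / s * Real.log (2 - (2 * p / (1 + p)) ^ s)

/-!
The vertices in `S` form a clique if and only if, in every coordinate, the symbols `0` and `1` do
not both occur among their subcubes. Giving `⋆` the weight `p` and the fixed values the weight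
`(1 - p) / 2` (the binomial model) makes the coordinates independent, so that cliques on `s`
vertices have total weight `q ^ d` with `q = columnWeight s p`. A subcube of the binomial model
that is conditioned on its dimension `k` is uniform, which costs a factor `B = binomialMass d k p`
per vertex. Every `p` therefore gives the bound `q ^ d / B ^ s` for the probability `cliqueProb`
that `s` uniform subcubes form a clique (`cliqueProb_le`), and `log B / d` tends to minus the
relative entropy of `α` with respect to `p`, of which the lower bound is what is needed
(`eventually_exp_le_binomialMass`).

If `alphaS s p = α`, this bound has the correct exponential rate: `alphaS s p` is the expected
proportion of wildcards in a member of a binomial clique, so typical binomial cliques have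
dimensions near `α d`. For the lower bound take a slightly smaller parameter `p'`. By Chernoff
bounds most of the clique weight is carried by families with all dimensions in `[β d, α d]`, where
`β < alphaS s p' < α`. Freeing coordinates keeps a clique a clique, so the clique probability
increases with the dimensions (`sum_unifWeight_mono`, `sum_prod_mono`), and all dimensions may be
raised to `k`. What is lost is the probability that `s` binomial variables exceed `β d`, which the
exponential Markov inequality bounds by the relative entropy again (`eventually_le_cliqueProb`,
`eventually_exp_le_cliqueProb`).

The first moment then shows that cliques do not appear early (`uniformModel_exists_clique_le`). For
the second moment, split the vertices into `s` blocks of size `m` and consider the tuples with one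
vertex in each block. Two `s`-sets with `j` common vertices are both cliques with probability at
most `(q ^ (d / s) / B) ^ (2 s - j)` (`uniformModel_inter_le`): coordinatewise this is the
inequality `pair_weight_pow_le`, which follows from the log-convexity of the pair weight in `j`
(`overlap_sq_le`). Summing over the pairs of tuples factorises over the blocks, and Chebyshev's
inequality yields `uniformModel_no_clique_le`.
-/

/-! ### The function `alphaS` and its inverse -/

/-- The weight of all `s`-columns over `{0, 1, ⋆}` in which `0` and `1` do not both occur, when the
entries are independent, `⋆` has probability `p`, and `0` and `1` have probability `(1 - p) / 2`. -/
noncomputable def columnWeight (s : ℕ) (p : ℝ) : ℝ := 2 * ((1 + p) / 2) ^ s - p ^ s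

theorem pow_le_half_pow {p : ℝ} (h0 : 0 ≤ p) (h1 : p ≤ 1) (s : ℕ) : p ^ s ≤ ((1 + p) / 2) ^ s :=
  pow_le_pow_left₀ h0 (by linarith) s

theorem columnWeight_pos {p : ℝ} (h0 : 0 ≤ p) (h1 : p ≤ 1) (s : ℕ) : 0 < columnWeight s p := by
  have h := pow_le_half_pow h0 h1 s
  have h2 : 0 < ((1 + p) / 2) ^ s := by positivity
  unfold columnWeight
  linarith

theorem columnWeight_mul_alphaS {p : ℝ} (h0 : 0 ≤ p) (h1 : p ≤ 1) (s : ℕ) :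
    columnWeight s p * alphaS s p = p * (2 * ((1 + p) / 2) ^ (s - 1) - p ^ (s - 1)) :=
  mul_div_cancel₀ _ (columnWeight_pos h0 h1 s).ne'

theorem one_sub_alphaS {p : ℝ} (h0 : 0 ≤ p) (h1 : p ≤ 1) {s : ℕ} (hs : 1 ≤ s) :
    1 - alphaS s p = ((1 + p) / 2) ^ (s - 1) * (1 - p) / columnWeight s p := by
  have hq := (columnWeight_pos h0 h1 s).ne'
  rw [eq_div_iff hq, sub_mul, mul_comm (alphaS s p), columnWeight_mul_alphaS h0 h1]
  obtain ⟨n, rfl⟩ : ∃ n, s = n + 1 := ⟨s - 1, by omega⟩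
  simp only [columnWeight, Nat.add_sub_cancel]
  ring

/-- In the variable `x = 2p / (1 + p)` the reciprocal of `1 - alphaS s p` is
`1 / (2 (1 - x)) + (1 + x + ⋯ + x ^ (s - 1)) / 2`, from which monotonicity can be read off. -/
theorem inv_one_sub_alphaS {p : ℝ} (h0 : 0 ≤ p) (h1 : p < 1) {s : ℕ} (hs : 1 ≤ s) :
    (1 - alphaS s p)⁻¹ = (1 + p) / 2 / (1 - p)
      + (∑ i ∈ Finset.range s, (2 * p / (1 + p)) ^ i) / 2 := by
  have hp : 1 + p ≠ 0 := by positivity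
  have hp' : 1 - p ≠ 0 := by linarith
  have hx : 2 * p / (1 + p) ≠ 1 := by
    rw [Ne, div_eq_one_iff_eq hp]
    intro h; apply hp'; linarith
  have ha : ((1 + p) / 2) ≠ 0 := by positivity
  rw [one_sub_alphaS h0 h1.le hs, geom_sum_eq hx, inv_div]
  have e1 : 2 * p / (1 + p) - 1 = - ((1 - p) / (1 + p)) := by field_simp; ring
  have e2 : (2 * p / (1 + p)) ^ s = p ^ s / ((1 + p) / 2) ^ s := by
    rw [← div_pow]; congr 1; field_simp
  have e3 : ((1 + p) / 2) ^ s = ((1 + p) / 2) ^ (s - 1) * ((1 + p) / 2) := by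
    rw [← pow_succ]; congr 1; omega
  have ha' : ((1 + p) / 2) ^ (s - 1) ≠ 0 := pow_ne_zero _ ha
  rw [e1, e2, columnWeight, e3]
  generalize ((1 + p) / 2) ^ (s - 1) = A at *
  generalize p ^ s = P
  field_simp
  ring

theorem alphaS_lt_one {p : ℝ} (h0 : 0 ≤ p) (h1 : p < 1) {s : ℕ} (hs : 1 ≤ s) :
    alphaS s p < 1 := by
  have h := one_sub_alphaS h0 h1.le hs
  have : 0 < 1 - alphaS s p := by
    rw [h]
    exact div_pos (mul_pos (by positivity) (by linarith)) (columnWeight_pos h0 h1.le s)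
  linarith

theorem alphaS_strictMonoOn {s : ℕ} (hs : 1 ≤ s) : StrictMonoOn (alphaS s) (Set.Ico 0 1) := by
  intro p hp r hr hpr
  have hp1 := alphaS_lt_one hp.1 hp.2 hs
  have hr1 := alphaS_lt_one hr.1 hr.2 hs
  have key : (1 - alphaS s p)⁻¹ < (1 - alphaS s r)⁻¹ := by
    rw [inv_one_sub_alphaS hp.1 hp.2 hs, inv_one_sub_alphaS hr.1 hr.2 hs]
    have h0 := hp.1
    have h0' := hr.1
    have h1 : (1 + p) / 2 / (1 - p) < (1 + r) / 2 / (1 - r) := by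
      rw [div_lt_div_iff₀ (by linarith [hp.2]) (by linarith [hr.2])]
      nlinarith
    have h2 : 2 * p / (1 + p) ≤ 2 * r / (1 + r) := by
      rw [div_le_div_iff₀ (by linarith) (by linarith)]
      nlinarith
    have h3 : ∑ i ∈ Finset.range s, (2 * p / (1 + p)) ^ i
        ≤ ∑ i ∈ Finset.range s, (2 * r / (1 + r)) ^ i :=
      Finset.sum_le_sum fun i _ => pow_le_pow_left₀ (by positivity) h2 i
    linarith
  rw [inv_lt_inv₀ (by linarith) (by linarith)] at key
  linarith

theorem alphaS_continuousOn (s : ℕ) : ContinuousOn (alphaS s) (Set.Icc 0 1) := by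
  unfold alphaS
  refine ContinuousOn.div (by fun_prop) (by fun_prop) fun p hp => ?_
  exact (columnWeight_pos hp.1 hp.2 s).ne'

theorem alphaS_pos {p : ℝ} (h0 : 0 < p) (h1 : p ≤ 1) (s : ℕ) : 0 < alphaS s p := by
  have h := pow_le_half_pow h0.le h1 (s - 1)
  have h2 : 0 < ((1 + p) / 2) ^ (s - 1) := by positivity
  exact div_pos (mul_pos h0 (by linarith)) (columnWeight_pos h0.le h1 s)

theorem alphaS_bijOn {s : ℕ} (hs : 1 ≤ s) :
    Set.BijOn (alphaS s) (Set.Ioo 0 1) (Set.Ioo 0 1) := by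
  refine ⟨fun p hp => ⟨alphaS_pos hp.1 hp.2.le s, alphaS_lt_one hp.1.le hp.2 hs⟩,
    ((alphaS_strictMonoOn hs).mono Set.Ioo_subset_Ico_self).injOn, fun y hy => ?_⟩
  have h0 : alphaS s 0 = 0 := by simp [alphaS]
  have h1 : alphaS s 1 = 1 := by norm_num [alphaS]
  obtain ⟨p, hp, rfl⟩ := intermediate_value_Icc zero_le_one (alphaS_continuousOn s)
    (by rw [h0, h1]; exact Set.Ioo_subset_Icc_self hy)
  refine ⟨p, ⟨lt_of_le_of_ne hp.1 ?_, lt_of_le_of_ne hp.2 ?_⟩, rfl⟩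
  · rintro rfl
    exact hy.1.ne' h0
  · rintro rfl
    exact hy.2.ne h1

theorem le_alphaS {p : ℝ} (h0 : 0 ≤ p) (h1 : p ≤ 1) {s : ℕ} (hs : 1 ≤ s) : p ≤ alphaS s p := by
  have h := one_sub_alphaS h0 h1 hs
  have hq := columnWeight_pos h0 h1 s
  have : 1 - alphaS s p ≤ 1 - p := by
    rw [h, div_le_iff₀ hq, mul_comm]
    refine mul_le_mul_of_nonneg_left ?_ (by linarith)
    obtain ⟨n, rfl⟩ : ∃ n, s = n + 1 := ⟨s - 1, by omega⟩
    have := mul_le_mul_of_nonneg_left (pow_le_half_pow h0 h1 n) h0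
    simp only [columnWeight, Nat.add_sub_cancel, pow_succ]
    linarith
  linarith

/-! ### The overlap inequality -/

/-- A positive log-convex sequence lies below the geometric interpolation of its end points. -/
theorem pow_le_of_sq_le_mul {G : ℕ → ℝ} {s : ℕ} (hpos : ∀ j ≤ s, 0 < G j)
    (hG : ∀ j, j + 2 ≤ s → G (j + 1) ^ 2 ≤ G j * G (j + 2)) {j : ℕ} (hj : j ≤ s) :
    G j ^ s ≤ G 0 ^ (s - j) * G s ^ j := by
  rcases hj.eq_or_lt with rfl | hlt
  · simp
  set r : ℝ := G (j + 1) / G j with hr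
  have hr0 : 0 < r := div_pos (hpos _ hlt) (hpos _ hj)
  -- consecutive ratios increase, so `r` bounds the earlier ratios above and the later ones below
  have mono : ∀ i k, i ≤ k → k + 1 ≤ s → G (i + 1) / G i ≤ G (k + 1) / G k := by
    intro i k hik
    induction k, hik using Nat.le_induction with
    | base => exact fun _ => le_rfl
    | succ k hik ih =>
      intro hk
      refine (ih (by omega)).trans ?_
      rw [div_le_div_iff₀ (hpos _ (by omega)) (hpos _ (by omega))]
      have := hG k (by omega)
      nlinarith
  have low : ∀ i ≤ j, G i ≤ r ^ i * G 0 := by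
    intro i
    induction i with
    | zero => simp
    | succ i ih =>
      intro hi
      have h := mono i j (by omega) hlt
      rw [div_le_iff₀ (hpos _ (by omega))] at h
      calc G (i + 1) ≤ r * G i := h
        _ ≤ r * (r ^ i * G 0) := mul_le_mul_of_nonneg_left (ih (by omega)) hr0.le
        _ = r ^ (i + 1) * G 0 := by ring
  have high : ∀ n, j + n ≤ s → r ^ n * G j ≤ G (j + n) := by
    intro n
    induction n with
    | zero => simp
    | succ n ih =>
      intro hn
      have h := mono j (j + n) (by omega) hn
      rw [le_div_iff₀ (hpos _ (by omega))] at h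
      calc r ^ (n + 1) * G j = r * (r ^ n * G j) := by ring
        _ ≤ r * G (j + n) := mul_le_mul_of_nonneg_left (ih (by omega)) hr0.le
        _ ≤ _ := h
  have hi := high (s - j) (by omega)
  rw [Nat.add_sub_cancel' hj] at hi
  have hGj := hpos j hj
  have hG0 := hpos 0 (by omega)
  calc G j ^ s = G j ^ (s - j) * G j ^ j := by rw [← pow_add, Nat.sub_add_cancel hj]
    _ ≤ (r ^ j * G 0) ^ (s - j) * G j ^ j := by
        gcongr
        exact low j le_rfl
    _ = G 0 ^ (s - j) * (r ^ (s - j) * G j) ^ j := by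
        rw [mul_pow, mul_pow, ← pow_mul, ← pow_mul, mul_comm j (s - j)]; ring
    _ ≤ G 0 ^ (s - j) * G s ^ j := by gcongr

/-- The normalised weight of the pairs of compatible columns that share `j` of their `s` entries. -/
noncomputable def overlap (s : ℕ) (x : ℝ) (j : ℕ) : ℝ :=
  2 + 2 * x ^ j - 4 * x ^ s + x ^ (2 * s - j)

theorem overlap_pos {x : ℝ} (h0 : 0 < x) (h1 : x < 1) {s j : ℕ} (hj : j ≤ s) :
    0 < overlap s x j := by
  have h := pow_le_pow_of_le_one h0.le h1.le hj
  have h2 : x ^ s ≤ 1 := pow_le_one₀ h0.le h1.le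
  have h3 : 0 < x ^ (2 * s - j) := pow_pos h0 _
  unfold overlap
  linarith

/-- Writing `y = x ^ s`, `A = 2 x ^ j` and `B = x ^ (2 s - j)`, log-convexity of `2 - 4 y + A + B`
amounts to `(2 - 4 y) (A + B) + 8 y ^ 2 ≥ 0`, which holds although `2 - 4 y` may be negative. -/
theorem overlap_sq_le {x : ℝ} (h0 : 0 < x) (h1 : x < 1) {s j : ℕ} (hj : j + 2 ≤ s) :
    overlap s x (j + 1) ^ 2 ≤ overlap s x j * overlap s x (j + 2) := by
  obtain ⟨m, rfl⟩ : ∃ m, s = j + 2 + m := ⟨s - (j + 2), by omega⟩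
  have e0 : 2 * (j + 2 + m) - j = j + 2 * m + 4 := by omega
  have e1 : 2 * (j + 2 + m) - (j + 1) = j + 2 * m + 3 := by omega
  have e2 : 2 * (j + 2 + m) - (j + 2) = j + 2 * m + 2 := by omega
  simp only [overlap, e0, e1, e2]
  set u := x ^ j with hu
  set v := x ^ m with hv
  have hu0 : 0 < u := pow_pos h0 _
  have hv0 : 0 < v := pow_pos h0 _
  have hu1 : u ≤ 1 := pow_le_one₀ h0.le h1.le
  have hv1 : v ≤ 1 := pow_le_one₀ h0.le h1.le
  have p1 : x ^ (j + 1) = u * x := by rw [pow_succ]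
  have p2 : x ^ (j + 2) = u * x ^ 2 := by rw [pow_add]
  have p3 : x ^ (j + 2 + m) = u * x ^ 2 * v := by rw [pow_add, pow_add]
  have p4 : x ^ (j + 2 * m + 4) = u * v ^ 2 * x ^ 4 := by rw [pow_add, pow_add, pow_mul']
  have p5 : x ^ (j + 2 * m + 3) = u * v ^ 2 * x ^ 3 := by rw [pow_add, pow_add, pow_mul']
  have p6 : x ^ (j + 2 * m + 2) = u * v ^ 2 * x ^ 2 := by rw [pow_add, pow_add, pow_mul']
  rw [p1, p2, p3, p4, p5, p6]
  set y := u * x ^ 2 * v with hy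
  have hy0 : 0 < y := by positivity
  -- `w = x ^ (j + 1)` is the middle power, `y ≤ w ≤ 1`
  set w := u * x with hw
  have hw0 : 0 < w := by positivity
  have hw1 : w ≤ 1 := mul_le_one₀ hu1 h0.le h1.le
  have hyw : y ≤ w := by
    have : x * v ≤ 1 := mul_le_one₀ h1.le hv0.le hv1
    calc y = w * (x * v) := by rw [hy, hw]; ring
      _ ≤ w * 1 := mul_le_mul_of_nonneg_left this hw0.le
      _ = w := mul_one w
  have hy1 : y ≤ 1 := hyw.trans hw1
  set B := u * v ^ 2 * x ^ 3 with hB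
  have hB0 : 0 < B := by positivity
  have hwB : w * B = y ^ 2 := by rw [hw, hB, hy]; ring
  have hAB : 2 * w + B ≤ 2 + y ^ 2 := by
    have hB1 : y ^ 2 ≤ B := by nlinarith
    have h2 : y ^ 2 ≤ w := by nlinarith
    nlinarith [mul_nonneg (sub_nonneg.2 hw1) (sub_nonneg.2 h2),
      mul_nonneg (sub_nonneg.2 hw1) (sub_nonneg.2 hyw)]
  have key : 0 ≤ (2 - 4 * y) * (2 * w + B) + 8 * y ^ 2 := by
    rcases le_total y (1 / 2) with h | h
    · have : 0 ≤ (2 - 4 * y) * (2 * w + B) := mul_nonneg (by linarith) (by linarith)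
      positivity
    · have : (4 * y - 2) * (2 * w + B) ≤ (4 * y - 2) * (2 + y ^ 2) :=
        mul_le_mul_of_nonneg_left hAB (by linarith)
      nlinarith [mul_nonneg (sub_nonneg.2 hy1) (sq_nonneg (3 * y - 2)), sq_nonneg (3 * y - 2),
        mul_nonneg hy0.le (sq_nonneg (3 * y - 2)), mul_nonneg hy0.le (sq_nonneg (y - 1))]
  have hx : 4 * x ≤ (x + 1) ^ 2 := by nlinarith [sq_nonneg (x - 1)]
  -- multiply by `x ^ 2` to express all terms through `w` and `B`
  have id1 : x ^ 2 * ((2 + 2 * u - 4 * y + u * v ^ 2 * x ^ 4)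
        * (2 + 2 * (u * x ^ 2) - 4 * y + u * v ^ 2 * x ^ 2)
        - (2 + 2 * w - 4 * y + B) ^ 2)
      = x * (x - 1) ^ 2 * ((2 - 4 * y) * (2 * w + B)) + 2 * (w * B) * (x - 1) ^ 2 * (x + 1) ^ 2 := by
    rw [hw, hB]; ring
  have id2 : 0 ≤ x * (x - 1) ^ 2 * ((2 - 4 * y) * (2 * w + B))
      + 2 * (w * B) * (x - 1) ^ 2 * (x + 1) ^ 2 := by
    rw [hwB]
    have t1 : 0 ≤ x * (x - 1) ^ 2 * ((2 - 4 * y) * (2 * w + B) + 8 * y ^ 2) :=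
      mul_nonneg (by positivity) key
    have t2 : 0 ≤ 2 * y ^ 2 * (x - 1) ^ 2 * ((x + 1) ^ 2 - 4 * x) :=
      mul_nonneg (by positivity) (by linarith)
    linarith
  rw [← id1] at id2
  have := nonneg_of_mul_nonneg_right id2 (by positivity)
  linarith

/-- The overlap inequality behind the second moment computation: a pair of compatible columns that
share `j` of `s` entries has weight at most `columnWeight s p ^ (2 - j / s)`. -/
theorem pair_weight_pow_le {p : ℝ} (h0 : 0 < p) (h1 : p < 1) {s j : ℕ} (hj : j ≤ s) :
    (2 * ((1 + p) / 2) ^ (2 * s - j) + 2 * p ^ j * ((1 + p) / 2) ^ (2 * (s - j))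
      - 4 * p ^ s * ((1 + p) / 2) ^ (s - j) + p ^ (2 * s - j)) ^ s
      ≤ columnWeight s p ^ (2 * s - j) := by
  set a := (1 + p) / 2 with ha
  have ha0 : 0 < a := by positivity
  set x := p / a with hx
  have hx0 : 0 < x := by positivity
  have hx1 : x < 1 := by rw [hx, div_lt_one ha0]; linarith
  have hpx : p = a * x := by rw [hx]; field_simp
  have e1 : columnWeight s p = a ^ s * overlap s x s := by
    have : 2 * s - s = s := by omega
    rw [columnWeight, ← ha, overlap, this, hpx, mul_pow]; ring
  have e2 : 2 * a ^ (2 * s - j) + 2 * p ^ j * a ^ (2 * (s - j))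
      - 4 * p ^ s * a ^ (s - j) + p ^ (2 * s - j) = a ^ (2 * s - j) * overlap s x j := by
    have t1 : a ^ (2 * s - j) = a ^ j * a ^ (2 * (s - j)) := by rw [← pow_add]; congr 1; omega
    have t2 : a ^ (2 * s - j) = a ^ s * a ^ (s - j) := by rw [← pow_add]; congr 1; omega
    have t3 : p ^ j * a ^ (2 * (s - j)) = a ^ (2 * s - j) * x ^ j := by rw [hpx, mul_pow, t1]; ring
    have t4 : p ^ s * a ^ (s - j) = a ^ (2 * s - j) * x ^ s := by rw [hpx, mul_pow, t2]; ring
    have t5 : p ^ (2 * s - j) = a ^ (2 * s - j) * x ^ (2 * s - j) := by rw [hpx, mul_pow]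
    rw [overlap, mul_assoc, t3, mul_assoc, t4, t5]; ring
  have e0 : overlap s x 0 = overlap s x s ^ 2 := by
    have : 2 * s - s = s := by omega
    simp only [overlap, this, pow_zero, Nat.sub_zero, pow_mul']; ring
  rw [e1, e2, mul_pow, mul_pow, ← pow_mul, ← pow_mul, mul_comm s]
  refine mul_le_mul_of_nonneg_left ?_ (by positivity)
  have := pow_le_of_sq_le_mul (G := overlap s x) (s := s) (fun j hj => overlap_pos hx0 hx1 hj)
    (fun j hj => overlap_sq_le hx0 hx1 hj) hj
  rw [e0, ← pow_mul, ← pow_add] at this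
  rwa [show 2 * (s - j) + j = 2 * s - j by omega] at this

/-! ### Compatible columns -/

/-- Two symbols are compatible when they are not `0` and `1`. -/
def SymCompat (a b : Option Bool) : Prop := a = none ∨ b = none ∨ a = b

/-- The entries of a column at the indices in `S` are pairwise compatible. -/
def ColCompat {ι : Type*} (S : Finset ι) (col : ι → Option Bool) : Prop :=
  ∀ u ∈ S, ∀ v ∈ S, SymCompat (col u) (col v)

/-- The subcubes `c u` with `u ∈ S` pairwise intersect, expressed through the columns of symbols. -/
def IsCubeClique {ι : Type*} {d : ℕ} (S : Finset ι) (c : ι → Subcube d) : Prop :=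
  ∀ i, ColCompat S fun u => c u i

theorem points_inter_nonempty_iff {d : ℕ} (c c' : Subcube d) :
    (c.points ∩ c'.points).Nonempty ↔ ∀ i, SymCompat (c i) (c' i) := by
  constructor
  · rintro ⟨x, hx, hx'⟩ i
    unfold SymCompat
    rcases h : c i with _ | b
    · exact Or.inl rfl
    rcases h' : c' i with _ | b'
    · exact Or.inr (Or.inl rfl)
    rw [← hx i b h, ← hx' i b' h']
    exact Or.inr (Or.inr rfl)
  · intro h
    refine ⟨fun i => ((c i).orElse fun _ => c' i).getD false, fun i b hb => ?_, fun i b hb => ?_⟩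
    · simp [hb]
    · rcases h i with h | h | h
      · simp [hb, h]
      · simp [hb] at h
      · simp [h, hb]

/-- The symbols that can occur in a column together with a fixed value `x`; for `x = none` only
the wildcard is allowed. -/
noncomputable def allowed (x o : Option Bool) : ℝ := if o = none ∨ o = x then 1 else 0

/-- The sign of the term `x` in the inclusion-exclusion formula for compatible columns. -/
noncomputable def colSign (x : Option Bool) : ℝ := if x = none then -1 else 1

open Classical in
/-- The indicator of the event `P`, as a real number. -/
noncomputable def ind (P : Prop) : ℝ := if P then 1 else 0

theorem ind_nonneg (P : Prop) : 0 ≤ ind P := by unfold ind; split_ifs <;> norm_num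

theorem ind_of {P : Prop} (h : P) : ind P = 1 := if_pos h

theorem ind_of_not {P : Prop} (h : ¬P) : ind P = 0 := if_neg h

theorem ind_mono {P Q : Prop} (h : P → Q) : ind P ≤ ind Q := by
  by_cases hP : P
  · rw [ind_of hP, ind_of (h hP)]
  · rw [ind_of_not hP]; exact ind_nonneg _

theorem ind_and (P Q : Prop) : ind (P ∧ Q) = ind P * ind Q := by
  by_cases hP : P <;> by_cases hQ : Q <;> simp [ind, hP, hQ]

theorem prod_ind {ι : Type*} [Fintype ι] (P : ι → Prop) : ∏ i, ind (P i) = ind (∀ i, P i) := by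
  by_cases h : ∀ i, P i
  · rw [ind_of h, Finset.prod_congr rfl fun i _ => ind_of (h i), Finset.prod_const_one]
  · rw [ind_of_not h]
    push Not at h
    obtain ⟨i, hi⟩ := h
    exact Finset.prod_eq_zero (Finset.mem_univ i) (ind_of_not hi)

theorem allowed_eq_ind (x o : Option Bool) : allowed x o = ind (o = none ∨ o = x) := by
  by_cases h : o = none ∨ o = x <;> simp [allowed, ind, h]

theorem prod_allowed {ι : Type*} (S : Finset ι) (x : Option Bool) (col : ι → Option Bool) :
    ∏ u ∈ S, allowed x (col u) = ind (∀ u ∈ S, col u = none ∨ col u = x) := by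
  rw [← Finset.prod_coe_sort]
  simp only [allowed_eq_ind]
  rw [prod_ind]
  congr 1
  simp

/-- A column is compatible if its entries lie in `{0, ⋆}` or in `{1, ⋆}`, and both hold only for
the all-wildcard column. This writes the indicator through product functions. -/
theorem ind_colCompat {ι : Type*} (S : Finset ι) (col : ι → Option Bool) :
    ind (ColCompat S col) = ∑ x, colSign x * ∏ u ∈ S, allowed x (col u) := by
  simp only [prod_allowed, colSign]
  rw [Fintype.sum_option, Fintype.sum_bool]
  simp only [if_true, reduceCtorEq, if_false, one_mul, neg_mul, or_self]
  by_cases h0 : ∀ u ∈ S, col u = none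
  · have hc : ColCompat S col := fun u hu v hv => Or.inl (h0 u hu)
    rw [ind_of hc, ind_of h0, ind_of fun u hu => Or.inl (h0 u hu),
      ind_of fun u hu => Or.inl (h0 u hu)]
    norm_num
  · rw [ind_of_not h0]
    push Not at h0
    obtain ⟨w, hw, hw0⟩ := h0
    obtain ⟨b, hb⟩ := Option.ne_none_iff_exists'.1 hw0
    have hcb : ColCompat S col ↔ ∀ u ∈ S, col u = none ∨ col u = some b := by
      constructor
      · intro h u hu
        rcases h u hu w hw with h | h | h
        · exact Or.inl h
        · exact absurd h hw0
        · exact Or.inr (h.trans hb)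
      · intro h u hu v hv
        rcases h u hu with h1 | h1
        · exact Or.inl h1
        rcases h v hv with h2 | h2
        · exact Or.inr (Or.inl h2)
        · exact Or.inr (Or.inr (h1.trans h2.symm))
    have hnb : ¬ ∀ u ∈ S, col u = none ∨ col u = some (!b) := by
      intro h
      rcases h w hw with h | h
      · exact hw0 h
      · rw [hb] at h; simp at h
    rw [show ind (ColCompat S col) = ind (∀ u ∈ S, col u = none ∨ col u = some b) by rw [hcb]]
    cases b
    · rw [ind_of_not (P := ∀ u ∈ S, col u = none ∨ col u = some true) hnb]; ring
    · rw [ind_of_not (P := ∀ u ∈ S, col u = none ∨ col u = some false) hnb]; ring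

/-! ### Binomial weights -/

/-- The symbol weights of the binomial model: `p` for the wildcard and `(1 - p) / 2` for the fixed
values. -/
noncomputable def symWeight (p : ℝ) (o : Option Bool) : ℝ := if o = none then p else (1 - p) / 2

/-- The weight of a family of subcubes in the binomial model. -/
noncomputable def famWeight {ι : Type*} [Fintype ι] {d : ℕ} (p : ℝ) (c : ι → Subcube d) : ℝ :=
  ∏ u, ∏ i, symWeight p (c u i)

theorem symWeight_nonneg {p : ℝ} (h0 : 0 ≤ p) (h1 : p ≤ 1) (o : Option Bool) :
    0 ≤ symWeight p o := by
  unfold symWeight; split_ifs <;> linarith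

theorem famWeight_nonneg {ι : Type*} [Fintype ι] {d : ℕ} {p : ℝ} (h0 : 0 ≤ p) (h1 : p ≤ 1)
    (c : ι → Subcube d) : 0 ≤ famWeight p c :=
  Finset.prod_nonneg fun _ _ => Finset.prod_nonneg fun _ _ => symWeight_nonneg h0 h1 _

theorem prod_sum_univ {ι κ : Type*} [Fintype ι] [DecidableEq ι] [Fintype κ] (f : ι → κ → ℝ) :
    ∑ x : ι → κ, ∏ i, f i (x i) = ∏ i, ∑ j, f i j := by
  rw [Finset.prod_univ_sum, Fintype.piFinset_univ]

/-- Product functions of the columns of a family of subcubes sum to a power. -/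
theorem sum_prod_columns {ι : Type*} [Fintype ι] [DecidableEq ι] {d : ℕ}
    (g : (ι → Option Bool) → ℝ) :
    ∑ c : ι → Subcube d, ∏ i, g (fun u => c u i) = (∑ col, g col) ^ d := by
  rw [Fintype.sum_pow]
  exact Fintype.sum_equiv (Equiv.piComm fun _ _ => Option Bool) _ _ fun c => rfl

theorem famWeight_eq {ι : Type*} [Fintype ι] {d : ℕ} (p : ℝ) (c : ι → Subcube d) :
    famWeight p c = ∏ i, ∏ u, symWeight p (c u i) := Finset.prod_comm

/-- The one-symbol weight compatible with `x` is `(1 + p) / 2` for a fixed value `x` and `p` for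
the wildcard. -/
noncomputable def allowedWeight (p : ℝ) (x : Option Bool) : ℝ :=
  if x = none then p else (1 + p) / 2

theorem sum_symWeight_allowed (p : ℝ) (x : Option Bool) :
    ∑ o, symWeight p o * allowed x o = allowedWeight p x := by
  rw [Fintype.sum_option, Fintype.sum_bool]
  rcases x with _ | b
  · simp [symWeight, allowed, allowedWeight]
  · cases b <;> simp [symWeight, allowed, allowedWeight] <;> ring

theorem sum_symWeight_allowed_mul (p : ℝ) (x y : Option Bool) :
    ∑ o, symWeight p o * (allowed x o * allowed y o)
      = if x = y then allowedWeight p x else p := by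
  rw [Fintype.sum_option, Fintype.sum_bool]
  rcases x with _ | b <;> rcases y with _ | b'
  · simp [symWeight, allowed, allowedWeight]
  · simp [symWeight, allowed]
  · simp [symWeight, allowed]
  · cases b <;> cases b' <;> simp [symWeight, allowed, allowedWeight] <;> ring

/-- The total weight of the compatible columns, with the wildcards in row `u₀` counted with an
extra factor `t`. -/
theorem sum_column_tilted {ι : Type*} [Fintype ι] [DecidableEq ι] (p t : ℝ) (u₀ : ι) :
    ∑ col : ι → Option Bool, (∏ u, symWeight p (col u)) * ind (ColCompat Finset.univ col)
        * (if col u₀ = none then t else 1)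
      = columnWeight (Fintype.card ι) p + (t - 1) *
        (p * (2 * ((1 + p) / 2) ^ (Fintype.card ι - 1) - p ^ (Fintype.card ι - 1))) := by
  set n := Fintype.card ι with hn
  have hn0 : 0 < n := Fintype.card_pos_iff.2 ⟨u₀⟩
  have key : ∀ x : Option Bool,
      ∑ col : ι → Option Bool, (∏ u, symWeight p (col u)) * (∏ u, allowed x (col u))
        * (if col u₀ = none then t else 1)
      = allowedWeight p x ^ (n - 1) * (allowedWeight p x + (t - 1) * p) := by
    intro x
    have e : ∀ col : ι → Option Bool, (∏ u, symWeight p (col u)) * (∏ u, allowed x (col u))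
        * (if col u₀ = none then t else 1)
        = ∏ u, symWeight p (col u) * allowed x (col u)
          * (if u = u₀ then (if col u = none then t else 1) else 1) := by
      intro col
      rw [Finset.prod_mul_distrib, Finset.prod_mul_distrib, Finset.prod_ite_eq']
      simp
    simp only [e]
    rw [prod_sum_univ fun u o => symWeight p o * allowed x o
      * (if u = u₀ then (if o = none then t else 1) else 1)]
    rw [← Finset.mul_prod_erase _ _ (Finset.mem_univ u₀)]
    have h1 : ∏ u ∈ Finset.univ.erase u₀, ∑ o, symWeight p o * allowed x o
        * (if u = u₀ then (if o = none then t else 1) else 1) = allowedWeight p x ^ (n - 1) := by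
      have : ∀ u ∈ Finset.univ.erase u₀, ∑ o, symWeight p o * allowed x o
          * (if u = u₀ then (if o = none then t else 1) else 1) = allowedWeight p x := by
        intro u hu
        simp only [if_neg (Finset.ne_of_mem_erase hu), mul_one, sum_symWeight_allowed]
      rw [Finset.prod_congr rfl this, Finset.prod_const, Finset.card_erase_of_mem
        (Finset.mem_univ _), Finset.card_univ]
    have h2 : ∑ o, symWeight p o * allowed x o * (if o = none then t else 1)
        = allowedWeight p x + (t - 1) * p := by
      rw [← sum_symWeight_allowed, Fintype.sum_option, Fintype.sum_option]
      simp [symWeight, allowed]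
      ring
    rw [h1]
    simp only [if_true]
    rw [h2, mul_comm]
  simp only [ind_colCompat, Finset.mul_sum, Finset.sum_mul]
  rw [Finset.sum_comm]
  have e2 : ∀ x : Option Bool, ∑ col : ι → Option Bool,
      (∏ u, symWeight p (col u)) * (colSign x * ∏ u, allowed x (col u))
        * (if col u₀ = none then t else 1)
      = colSign x * (allowedWeight p x ^ (n - 1) * (allowedWeight p x + (t - 1) * p)) := by
    intro x
    rw [← key x, Finset.mul_sum]
    exact Finset.sum_congr rfl fun col _ => by ring
  simp only [e2]
  rw [Fintype.sum_option, Fintype.sum_bool]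
  obtain ⟨m, hm⟩ : ∃ m, n = m + 1 := ⟨n - 1, by omega⟩
  simp only [colSign, allowedWeight, columnWeight, hm, Nat.add_sub_cancel, if_true, reduceCtorEq,
    if_false]
  ring

/-- The weight of the columns that are compatible on both `S` and `S'`, where the two sets have
size `s` and cover the index set. -/
theorem sum_column_pair {ι : Type*} [Fintype ι] [DecidableEq ι] (p : ℝ) {S S' : Finset ι} {s : ℕ}
    (hS : S.card = s) (hS' : S'.card = s) (hU : S ∪ S' = Finset.univ) :
    ∑ col : ι → Option Bool, (∏ u, symWeight p (col u)) * (ind (ColCompat S col)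
        * ind (ColCompat S' col))
      = 2 * ((1 + p) / 2) ^ (2 * s - (S ∩ S').card)
        + 2 * p ^ (S ∩ S').card * ((1 + p) / 2) ^ (2 * (s - (S ∩ S').card))
        - 4 * p ^ s * ((1 + p) / 2) ^ (s - (S ∩ S').card) + p ^ (2 * s - (S ∩ S').card) := by
  set j := (S ∩ S').card with hj
  have c1 : (S \ S').card = s - j := by rw [Finset.card_sdiff, Finset.inter_comm, hS]
  have c2 : (S' \ S).card = s - j := by rw [Finset.card_sdiff, hS']
  have hjs : j ≤ s := hS ▸ Finset.card_le_card Finset.inter_subset_left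
  have key : ∀ x y : Option Bool,
      ∑ col : ι → Option Bool, (∏ u, symWeight p (col u))
        * ((∏ u ∈ S, allowed x (col u)) * ∏ u ∈ S', allowed y (col u))
      = (if x = y then allowedWeight p x else p) ^ j * allowedWeight p x ^ (s - j)
        * allowedWeight p y ^ (s - j) := by
    intro x y
    have e : ∀ col : ι → Option Bool, (∏ u, symWeight p (col u))
        * ((∏ u ∈ S, allowed x (col u)) * ∏ u ∈ S', allowed y (col u))
        = ∏ u, symWeight p (col u) * ((if u ∈ S then allowed x (col u) else 1)
          * (if u ∈ S' then allowed y (col u) else 1)) := by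
      intro col
      rw [Finset.prod_mul_distrib, Finset.prod_mul_distrib, Finset.prod_ite_mem,
        Finset.prod_ite_mem, Finset.univ_inter, Finset.univ_inter]
    simp only [e]
    rw [prod_sum_univ fun u o => symWeight p o * ((if u ∈ S then allowed x o else 1)
          * (if u ∈ S' then allowed y o else 1))]
    have hsplit : (Finset.univ : Finset ι) = (S ∩ S') ∪ (S \ S') ∪ (S' \ S) := by
      rw [← hU]; ext u; simp only [Finset.mem_union, Finset.mem_inter, Finset.mem_sdiff]; tauto
    rw [hsplit, Finset.prod_union, Finset.prod_union]
    · congr 1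
      · congr 1
        · rw [hj, ← Finset.prod_const]
          refine Finset.prod_congr rfl fun u hu => ?_
          rw [Finset.mem_inter] at hu
          simp only [hu.1, hu.2, if_true]
          exact sum_symWeight_allowed_mul p x y
        · rw [← c1, ← Finset.prod_const]
          refine Finset.prod_congr rfl fun u hu => ?_
          rw [Finset.mem_sdiff] at hu
          simp only [hu.1, hu.2, if_true, if_false, mul_one]
          exact sum_symWeight_allowed p x
      · rw [← c2, ← Finset.prod_const]
        refine Finset.prod_congr rfl fun u hu => ?_
        rw [Finset.mem_sdiff] at hu
        simp only [hu.1, hu.2, if_true, if_false, one_mul]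
        exact sum_symWeight_allowed p y
    · exact (Finset.disjoint_sdiff_inter S S').symm
    · rw [Finset.disjoint_left]
      intro u hu
      simp only [Finset.mem_union, Finset.mem_inter, Finset.mem_sdiff] at hu ⊢
      tauto
  have e2 : ∀ col : ι → Option Bool, (∏ u, symWeight p (col u)) * (ind (ColCompat S col)
        * ind (ColCompat S' col)) = ∑ x, ∑ y, colSign x * colSign y
          * ((∏ u, symWeight p (col u))
        * ((∏ u ∈ S, allowed x (col u)) * ∏ u ∈ S', allowed y (col u))) := by
    intro col
    rw [ind_colCompat, ind_colCompat, Finset.sum_mul_sum, Finset.mul_sum]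
    refine Finset.sum_congr rfl fun x _ => ?_
    rw [Finset.mul_sum]
    exact Finset.sum_congr rfl fun y _ => by ring
  simp only [e2]
  rw [Finset.sum_comm]
  have e3 : ∀ x : Option Bool, ∑ col : ι → Option Bool, ∑ y, colSign x * colSign y
          * ((∏ u, symWeight p (col u))
        * ((∏ u ∈ S, allowed x (col u)) * ∏ u ∈ S', allowed y (col u)))
      = ∑ y, colSign x * colSign y * ((if x = y then allowedWeight p x else p) ^ j
        * allowedWeight p x ^ (s - j) * allowedWeight p y ^ (s - j)) := by
    intro x
    rw [Finset.sum_comm]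
    refine Finset.sum_congr rfl fun y _ => ?_
    rw [← Finset.mul_sum, key]
  simp only [e3]
  simp only [Fintype.sum_option, Fintype.sum_bool]
  have t0 : s = j + (s - j) := by omega
  have t1 : 2 * s - j = j + (s - j) + (s - j) := by omega
  have t2 : p ^ s = p ^ j * p ^ (s - j) := by rw [← pow_add, ← t0]
  rw [t1, t2, pow_mul']
  simp [colSign, allowedWeight, pow_add]
  ring

theorem ind_isCubeClique {ι : Type*} {d : ℕ} (S : Finset ι) (c : ι → Subcube d) :
    ind (IsCubeClique S c) = ∏ i, ind (ColCompat S fun u => c u i) :=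
  (prod_ind _).symm

/-- The binomial weight of the pairs of cliques with vertex sets `S` and `S'`. -/
theorem sum_famWeight_pair {ι : Type*} [Fintype ι] [DecidableEq ι] (d : ℕ) (p : ℝ)
    {S S' : Finset ι} {s : ℕ} (hS : S.card = s) (hS' : S'.card = s) (hU : S ∪ S' = Finset.univ) :
    ∑ c : ι → Subcube d, famWeight p c * ind (IsCubeClique S c ∧ IsCubeClique S' c)
      = (2 * ((1 + p) / 2) ^ (2 * s - (S ∩ S').card)
        + 2 * p ^ (S ∩ S').card * ((1 + p) / 2) ^ (2 * (s - (S ∩ S').card))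
        - 4 * p ^ s * ((1 + p) / 2) ^ (s - (S ∩ S').card)
        + p ^ (2 * s - (S ∩ S').card)) ^ d := by
  rw [← sum_column_pair p hS hS' hU, ← sum_prod_columns]
  refine Finset.sum_congr rfl fun c _ => ?_
  rw [ind_and, ind_isCubeClique, ind_isCubeClique, famWeight_eq, ← Finset.prod_mul_distrib,
    ← Finset.prod_mul_distrib]

/-- The generating function of the number of wildcards of one member of a clique in the binomial
model is that of a binomial distribution with parameter `alphaS s p`. -/
theorem sum_famWeight_tilted {ι : Type*} [Fintype ι] [DecidableEq ι] (d : ℕ) {p : ℝ} (h0 : 0 ≤ p)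
    (h1 : p ≤ 1) (t : ℝ) (u₀ : ι) :
    ∑ c : ι → Subcube d, famWeight p c * ind (IsCubeClique Finset.univ c) * t ^ (c u₀).dim
      = columnWeight (Fintype.card ι) p ^ d
        * (1 - alphaS (Fintype.card ι) p + alphaS (Fintype.card ι) p * t) ^ d := by
  have := sum_column_tilted p t u₀
  rw [← columnWeight_mul_alphaS h0 h1] at this
  rw [← mul_pow, show columnWeight (Fintype.card ι) p * (1 - alphaS (Fintype.card ι) p
    + alphaS (Fintype.card ι) p * t) = columnWeight (Fintype.card ι) p
      + (t - 1) * (columnWeight (Fintype.card ι) p * alphaS (Fintype.card ι) p) by ring,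
    ← this, ← sum_prod_columns]
  refine Finset.sum_congr rfl fun c _ => ?_
  rw [ind_isCubeClique, famWeight_eq, Finset.prod_mul_distrib, Finset.prod_mul_distrib]
  congr 1
  rw [Subcube.dim, Finset.prod_ite, Finset.prod_const, Finset.prod_const_one, mul_one]

theorem sum_famWeight_clique {ι : Type*} [Fintype ι] [DecidableEq ι] [Nonempty ι] (d : ℕ) {p : ℝ}
    (h0 : 0 ≤ p) (h1 : p ≤ 1) :
    ∑ c : ι → Subcube d, famWeight p c * ind (IsCubeClique Finset.univ c)
      = columnWeight (Fintype.card ι) p ^ d := by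
  simpa using sum_famWeight_tilted d h0 h1 1 (Classical.arbitrary ι)

/-! ### Uniform weights -/

theorem card_subcubesOfDim (d k : ℕ) : (subcubesOfDim d k).card = d.choose k * 2 ^ (d - k) := by
  classical
  have hmaps : ∀ c ∈ subcubesOfDim d k, (Finset.univ.filter fun i => c i = none)
      ∈ Finset.powersetCard k (Finset.univ : Finset (Fin d)) := by
    intro c hc
    rw [Finset.mem_powersetCard]
    exact ⟨Finset.subset_univ _, (Finset.mem_filter.1 hc).2⟩
  rw [Finset.card_eq_sum_card_fiberwise hmaps]
  have hfib : ∀ T ∈ Finset.powersetCard k (Finset.univ : Finset (Fin d)),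
      ((subcubesOfDim d k).filter fun c => (Finset.univ.filter fun i => c i = none) = T).card
        = 2 ^ (d - k) := by
    intro T hT
    have hTk := (Finset.mem_powersetCard.1 hT).2
    have e : ((subcubesOfDim d k).filter fun c => (Finset.univ.filter fun i => c i = none) = T)
        = Fintype.piFinset fun i => if i ∈ T then {none} else {some true, some false} := by
      ext c
      simp only [Finset.mem_filter, Fintype.mem_piFinset, subcubesOfDim, Finset.mem_univ, true_and]
      constructor
      · rintro ⟨-, rfl⟩ i
        rcases h : c i with _ | b
        · simp [h]
        · cases b <;> simp [h]
      · intro h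
        have hT' : (Finset.univ.filter fun i => c i = none) = T := by
          ext i
          have := h i
          by_cases hi : i ∈ T
          · simpa [hi] using this
          · simp only [hi, if_false, Finset.mem_insert, Finset.mem_singleton] at this
            rcases this with h | h <;> simp [h, hi]
        exact ⟨by rw [Subcube.dim, hT', hTk], hT'⟩
    rw [e, Fintype.card_piFinset]
    have : ∀ i : Fin d, (if i ∈ T then ({none} : Finset (Option Bool))
        else {some true, some false}).card = if i ∈ T then 1 else 2 := by
      intro i; split_ifs <;> simp
    simp only [this]
    rw [Finset.prod_ite, Finset.prod_const_one, Finset.prod_const, one_mul]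
    congr 1
    rw [Finset.filter_not, Finset.card_sdiff]
    simp [hTk]
  rw [Finset.sum_congr rfl hfib, Finset.sum_const, Finset.card_powersetCard]
  simp

/-- The probability of a single subcube under the uniform law on `k`-dimensional subcubes. -/
noncomputable def unifWeight (d k : ℕ) (c : Subcube d) : ℝ :=
  if c.dim = k then ((subcubesOfDim d k).card : ℝ)⁻¹ else 0

theorem unifWeight_nonneg (d k : ℕ) (c : Subcube d) : 0 ≤ unifWeight d k c := by
  unfold unifWeight; split_ifs <;> positivity

/-- The probability that a binomial variable with parameters `d` and `p` equals `k`. -/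
noncomputable def binomialMass (d k : ℕ) (p : ℝ) : ℝ := d.choose k * p ^ k * (1 - p) ^ (d - k)

theorem binomialMass_pos {d k : ℕ} (hk : k ≤ d) {p : ℝ} (h0 : 0 < p) (h1 : p < 1) :
    0 < binomialMass d k p := by
  have : 0 < d.choose k := Nat.choose_pos hk
  have : 0 < 1 - p := by linarith
  unfold binomialMass
  positivity

theorem prod_symWeight {d : ℕ} (p : ℝ) (c : Subcube d) :
    ∏ i, symWeight p (c i) = p ^ c.dim * ((1 - p) / 2) ^ (d - c.dim) := by
  unfold symWeight Subcube.dim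
  rw [Finset.prod_ite, Finset.prod_const, Finset.prod_const]
  congr 2
  rw [Finset.filter_not, Finset.card_sdiff]
  simp

/-- Conditioned on having dimension `k`, a subcube of the binomial model is uniform. -/
theorem unifWeight_mul_binomialMass {d k : ℕ} (hk : k ≤ d) (p : ℝ) (c : Subcube d) :
    unifWeight d k c * binomialMass d k p
      = if c.dim = k then ∏ i, symWeight p (c i) else 0 := by
  unfold unifWeight
  split_ifs with h
  · have h1 : (d.choose k : ℝ) ≠ 0 := by
      have := Nat.choose_pos hk
      positivity
    rw [prod_symWeight, h, card_subcubesOfDim, binomialMass, div_pow]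
    push_cast
    field_simp
  · rw [zero_mul]

theorem unifWeight_le {d k : ℕ} (hk : k ≤ d) {p : ℝ} (h0 : 0 < p) (h1 : p < 1) (c : Subcube d) :
    unifWeight d k c ≤ (∏ i, symWeight p (c i)) / binomialMass d k p := by
  rw [le_div_iff₀ (binomialMass_pos hk h0 h1), unifWeight_mul_binomialMass hk]
  split_ifs
  · exact le_rfl
  · exact Finset.prod_nonneg fun i _ => symWeight_nonneg h0.le h1.le _

instance {d k : ℕ} (hk : k ≤ d) : IsProbabilityMeasure (uniformModel hk) :=
  inferInstanceAs (IsProbabilityMeasure (Measure.infinitePi _))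

theorem uniformSubcubeLaw_singleton {d k : ℕ} (hk : k ≤ d) (c : Subcube d) :
    (uniformSubcubeLaw hk).real {c} = unifWeight d k c := by
  classical
  rw [Measure.real, uniformSubcubeLaw, PMF.toMeasure_apply_singleton _ _ (by measurability),
    PMF.uniformOfFinset_apply]
  unfold unifWeight subcubesOfDim
  by_cases h : c.dim = k
  · simp [h]
  · simp [h]

/-- The probability of an event that depends on finitely many vertices only, as a finite sum. -/
theorem uniformModel_real {d k : ℕ} (hk : k ≤ d) (U : Finset ℕ)
    (P : (U → Subcube d) → Prop) :
    (uniformModel hk).real {f | P fun u => f u}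
      = ∑ c, (∏ u, unifWeight d k (c u)) * ind (P c) := by
  classical
  have h1 : {f : ℕ → Subcube d | P fun u : U => f u} = U.restrict ⁻¹' {c | P c} := rfl
  have hm : Measurable (U.restrict : (ℕ → Subcube d) → (U → Subcube d)) :=
    Finset.measurable_restrict U
  have hPm : MeasurableSet {c : U → Subcube d | P c} := (Set.toFinite _).measurableSet
  rw [h1, uniformModel, ← map_measureReal_apply hm hPm, Measure.infinitePi_map_restrict]
  have h2 : {c : U → Subcube d | P c} = ↑(Finset.univ.filter fun c : U → Subcube d => P c) := by
    ext; simp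
  rw [h2, ← sum_measureReal_singleton, Finset.sum_filter]
  refine Finset.sum_congr rfl fun c _ => ?_
  by_cases hc : P c
  · rw [if_pos hc, ind_of hc, mul_one, Measure.real, Measure.pi_singleton, ENNReal.toReal_prod]
    exact Finset.prod_congr rfl fun u _ => uniformSubcubeLaw_singleton hk _
  · rw [if_neg hc, ind_of_not hc, mul_zero]

theorem measurableSet_finite_vertices {d : ℕ} (U : Finset ℕ)
    (P : (U → Subcube d) → Prop) : MeasurableSet {f : ℕ → Subcube d | P fun u => f u} := by
  have hPm : MeasurableSet {c : U → Subcube d | P c} := (Set.toFinite _).measurableSet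
  exact (Finset.measurable_restrict U) hPm

/-- The event that the vertices in `S` form a clique. -/
def cliqueEvent (d : ℕ) (S : Finset ℕ) : Set (ℕ → Subcube d) := {f | IsCubeClique S f}

theorem isCubeClique_subtype {d : ℕ} {S U : Finset ℕ} (hSU : S ⊆ U) (f : ℕ → Subcube d) :
    IsCubeClique (S.subtype (· ∈ U)) (fun u : {x // x ∈ U} => f u) ↔ IsCubeClique S f := by
  constructor
  · intro h i u hu v hv
    exact h i ⟨u, hSU hu⟩ (by simpa using hu) ⟨v, hSU hv⟩ (by simpa using hv)
  · intro h i u hu v hv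
    exact h i u (by simpa using hu) v (by simpa using hv)

theorem cliqueEvent_eq (d : ℕ) {S U : Finset ℕ} (hSU : S ⊆ U) :
    cliqueEvent d S = {f | IsCubeClique (S.subtype (· ∈ U)) fun u : {x // x ∈ U} => f u} := by
  ext f
  exact (isCubeClique_subtype hSU f).symm

theorem measurableSet_cliqueEvent (d : ℕ) (S : Finset ℕ) : MeasurableSet (cliqueEvent d S) := by
  rw [cliqueEvent_eq d (subset_refl S)]
  exact measurableSet_finite_vertices S _

theorem card_subtype_of_subset {S U : Finset ℕ} (hSU : S ⊆ U) :
    (S.subtype (· ∈ U)).card = S.card := by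
  rw [Finset.card_subtype, Finset.filter_true_of_mem fun x hx => hSU hx]

/-- The probability that `s` independent uniformly random `k`-dimensional subcubes pairwise
intersect. -/
noncomputable def cliqueProb (d k s : ℕ) : ℝ :=
  ∑ c : Fin s → Subcube d, (∏ u, unifWeight d k (c u)) * ind (IsCubeClique Finset.univ c)

theorem uniformModel_cliqueEvent {d k : ℕ} (hk : k ≤ d) (S : Finset ℕ) :
    (uniformModel hk).real (cliqueEvent d S) = cliqueProb d k S.card := by
  rw [cliqueEvent_eq d (subset_refl S), uniformModel_real hk S fun c =>
    IsCubeClique (S.subtype (· ∈ S)) c, cliqueProb]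
  refine Fintype.sum_equiv (Equiv.arrowCongr S.equivFin (Equiv.refl _)) _ _ fun c => ?_
  congr 1
  · exact Fintype.prod_equiv S.equivFin _ _ fun u => by simp
  · congr 1
    refine propext ⟨fun h i u _ v _ => ?_, fun h i u _ v _ => ?_⟩
    · exact h i _ (by simp) _ (by simp)
    · simpa using h i (S.equivFin u) (Finset.mem_univ _) (S.equivFin v) (Finset.mem_univ _)

theorem cliqueProb_nonneg (d k s : ℕ) : 0 ≤ cliqueProb d k s :=
  Finset.sum_nonneg fun _ _ =>
    mul_nonneg (Finset.prod_nonneg fun _ _ => unifWeight_nonneg _ _ _) (ind_nonneg _)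

theorem cliqueProb_le_one {d k : ℕ} (hk : k ≤ d) (s : ℕ) : cliqueProb d k s ≤ 1 := by
  have := uniformModel_cliqueEvent hk (Finset.range s)
  rw [Finset.card_range] at this
  rw [← this]
  exact measureReal_le_one

/-- Comparison of the uniform model with the binomial model: an event of the uniform model is the
same event of the binomial model, restricted to families of `k`-dimensional subcubes. -/
theorem sum_unifWeight_le {ι : Type*} [Fintype ι] [DecidableEq ι] {d k : ℕ} (hk : k ≤ d) {p : ℝ}
    (h0 : 0 < p) (h1 : p < 1) (P : (ι → Subcube d) → Prop) :
    ∑ c, (∏ u, unifWeight d k (c u)) * ind (P c)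
      ≤ (∑ c, famWeight p c * ind (P c)) / binomialMass d k p ^ Fintype.card ι := by
  rw [Finset.sum_div]
  refine Finset.sum_le_sum fun c _ => ?_
  rw [mul_div_right_comm]
  refine mul_le_mul_of_nonneg_right ?_ (ind_nonneg _)
  calc ∏ u, unifWeight d k (c u) ≤ ∏ u, (∏ i, symWeight p (c u i)) / binomialMass d k p :=
        Finset.prod_le_prod (fun u _ => unifWeight_nonneg _ _ _) fun u _ =>
          unifWeight_le hk h0 h1 _
    _ = _ := by rw [Finset.prod_div_distrib, Finset.prod_const, Finset.card_univ, famWeight]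

theorem cliqueProb_le {d k : ℕ} (hk : k ≤ d) {p : ℝ} (h0 : 0 < p) (h1 : p < 1) {s : ℕ}
    (hs : 1 ≤ s) : cliqueProb d k s ≤ columnWeight s p ^ d / binomialMass d k p ^ s := by
  have : Nonempty (Fin s) := ⟨⟨0, hs⟩⟩
  have := sum_unifWeight_le (ι := Fin s) hk h0 h1 (IsCubeClique Finset.univ)
  rwa [sum_famWeight_clique d h0.le h1.le, Fintype.card_fin] at this

/-- The probability that two sets of `s` vertices with `j` common elements are both cliques, in
terms of `r = columnWeight s p ^ (1 / s)`. -/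
theorem uniformModel_inter_le {d k : ℕ} (hk : k ≤ d) {p : ℝ} (h0 : 0 < p) (h1 : p < 1) {s : ℕ}
    (hs : 1 ≤ s) {r : ℝ} (hr : 0 ≤ r) (hrs : r ^ s = columnWeight s p) {S S' : Finset ℕ}
    (hS : S.card = s) (hS' : S'.card = s) :
    (uniformModel hk).real (cliqueEvent d S ∩ cliqueEvent d S')
      ≤ (r ^ d / binomialMass d k p) ^ (2 * s - (S ∩ S').card) := by
  classical
  set U := S ∪ S' with hU
  have hSU : S ⊆ U := Finset.subset_union_left
  have hSU' : S' ⊆ U := Finset.subset_union_right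
  set A := S.subtype (· ∈ U)
  set A' := S'.subtype (· ∈ U)
  have e : cliqueEvent d S ∩ cliqueEvent d S'
      = {f | (fun c : U → Subcube d => IsCubeClique A c ∧ IsCubeClique A' c) fun u => f u} := by
    rw [cliqueEvent_eq d hSU, cliqueEvent_eq d hSU']
    rfl
  have hA : A.card = s := by rw [card_subtype_of_subset hSU, hS]
  have hA' : A'.card = s := by rw [card_subtype_of_subset hSU', hS']
  have hAA : A ∪ A' = Finset.univ := by
    ext ⟨u, hu⟩
    simpa [A, A'] using Finset.mem_union.1 hu
  have hAi : (A ∩ A').card = (S ∩ S').card := by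
    have : A ∩ A' = (S ∩ S').subtype (· ∈ U) := by
      ext u; simp [A, A']
    rw [this, card_subtype_of_subset (Finset.inter_subset_left.trans hSU)]
  have hj : (S ∩ S').card ≤ s := hS ▸ Finset.card_le_card Finset.inter_subset_left
  have hcard : Fintype.card U = 2 * s - (S ∩ S').card := by
    have := Finset.card_union_add_card_inter S S'
    rw [← hU] at this
    rw [Fintype.card_coe]
    omega
  rw [e, uniformModel_real hk U fun c => IsCubeClique A c ∧ IsCubeClique A' c]
  refine (sum_unifWeight_le hk h0 h1 _).trans ?_
  have hw := sum_famWeight_pair d p hA hA' hAA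
  have hcol := sum_column_pair p hA hA' hAA
  rw [hAi] at hw hcol
  rw [hw, hcard]
  have hB := binomialMass_pos hk h0 h1
  have hpw := pair_weight_pow_le h0 h1 hj
  rw [← hcol] at hpw ⊢
  have hQ : 0 ≤ ∑ col : U → Option Bool, (∏ u, symWeight p (col u)) * (ind (ColCompat A col)
      * ind (ColCompat A' col)) :=
    Finset.sum_nonneg fun col _ => mul_nonneg
      (Finset.prod_nonneg fun u _ => symWeight_nonneg h0.le h1.le _)
      (mul_nonneg (ind_nonneg _) (ind_nonneg _))
  rw [← hrs, ← pow_mul, mul_comm s, pow_mul] at hpw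
  have hle := (pow_le_pow_iff_left₀ hQ (by positivity) (by omega)).1 hpw
  rw [div_pow, ← pow_mul, mul_comm d, pow_mul]
  exact div_le_div_of_nonneg_right (pow_le_pow_left₀ hQ hle d) (by positivity)

/-! ### The second moment method -/

/-- Chebyshev's inequality for a sum of indicators of events of equal probability `F`: if the pair
probabilities exceed `F ^ 2` by at most `e v w`, it is unlikely that none of the events occurs. -/
theorem measureReal_no_event_le {Ω ι : Type*} [MeasurableSpace Ω] {μ : Measure Ω}
    [IsProbabilityMeasure μ] [Fintype ι] (E : ι → Set Ω) (hE : ∀ v, MeasurableSet (E v)) {F : ℝ}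
    (hF : ∀ v, μ.real (E v) = F) (e : ι → ι → ℝ)
    (he : ∀ v w, μ.real (E v ∩ E w) ≤ F ^ 2 + e v w) :
    μ.real {ω | ∀ v, ω ∉ E v} * (Fintype.card ι * F) ^ 2 ≤ ∑ v, ∑ w, e v w := by
  classical
  set N : ℝ := (Fintype.card ι : ℝ) with hN
  set X : Ω → ℝ := fun ω => ∑ v, (E v).indicator 1 ω with hX
  have hint : ∀ A : Set Ω, MeasurableSet A → Integrable (A.indicator (1 : Ω → ℝ)) μ :=
    fun A hA => (integrable_const 1).indicator hA
  have hXi : Integrable X μ := integrable_finsetSum _ fun v _ => hint _ (hE v)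
  have hXint : ∫ ω, X ω ∂μ = N * F := by
    rw [hX, integral_finsetSum _ fun v _ => hint _ (hE v)]
    simp [integral_indicator_one, hE, hF, hN]
  have hX2 : ∀ ω, X ω ^ 2 = ∑ v, ∑ w, (E v ∩ E w).indicator (1 : Ω → ℝ) ω := by
    intro ω
    rw [sq, hX, Finset.sum_mul_sum]
    refine Finset.sum_congr rfl fun v _ => Finset.sum_congr rfl fun w _ => ?_
    rw [Set.inter_indicator_one, Pi.mul_apply]
  have hX2i : Integrable (fun ω => X ω ^ 2) μ := by
    simp only [hX2]
    exact integrable_finsetSum _ fun v _ => integrable_finsetSum _ fun w _ =>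
      hint _ ((hE v).inter (hE w))
  have hX2int : ∫ ω, X ω ^ 2 ∂μ ≤ (N * F) ^ 2 + ∑ v, ∑ w, e v w := by
    simp only [hX2]
    rw [integral_finsetSum _ fun v _ => integrable_finsetSum _ fun w _ =>
      hint _ ((hE v).inter (hE w))]
    have : ∀ v, ∫ ω, ∑ w, (E v ∩ E w).indicator (1 : Ω → ℝ) ω ∂μ = ∑ w, μ.real (E v ∩ E w) := by
      intro v
      rw [integral_finsetSum _ fun w _ => hint _ ((hE v).inter (hE w))]
      exact Finset.sum_congr rfl fun w _ => integral_indicator_one ((hE v).inter (hE w))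
    simp only [this]
    calc ∑ v, ∑ w, μ.real (E v ∩ E w) ≤ ∑ v : ι, ∑ w : ι, (F ^ 2 + e v w) :=
          Finset.sum_le_sum fun v _ => Finset.sum_le_sum fun w _ => he v w
      _ = (N * F) ^ 2 + ∑ v, ∑ w, e v w := by
          simp only [Finset.sum_add_distrib, Finset.sum_const, Finset.card_univ, nsmul_eq_mul, hN]
          ring
  have hvar : ∫ ω, (X ω - N * F) ^ 2 ∂μ ≤ ∑ v, ∑ w, e v w := by
    have e1 : ∀ ω, (X ω - N * F) ^ 2 = X ω ^ 2 - 2 * (N * F) * X ω + (N * F) ^ 2 := by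
      intro ω; ring
    have hsub : Integrable (fun ω => X ω ^ 2 - 2 * (N * F) * X ω) μ := hX2i.sub (hXi.const_mul _)
    simp only [e1]
    rw [integral_add hsub (integrable_const _),
      integral_sub hX2i (hXi.const_mul _), integral_const_mul, hXint]
    simp
    nlinarith
  have hgi : Integrable (fun ω => (X ω - N * F) ^ 2) μ := by
    have e1 : (fun ω => (X ω - N * F) ^ 2)
        = fun ω => X ω ^ 2 - 2 * (N * F) * X ω + (N * F) ^ 2 := by
      funext ω; ring
    rw [e1]
    exact (hX2i.sub (hXi.const_mul _)).add (integrable_const _)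
  have hmk := mul_meas_ge_le_integral_of_nonneg (μ := μ)
    (Filter.Eventually.of_forall fun ω => sq_nonneg (X ω - N * F)) hgi ((N * F) ^ 2)
  refine le_trans ?_ (hmk.trans hvar)
  rw [mul_comm]
  refine mul_le_mul_of_nonneg_left (measureReal_mono fun ω hω => ?_) (sq_nonneg _)
  have : X ω = 0 := Finset.sum_eq_zero fun v _ => Set.indicator_of_notMem (hω v) _
  simp [this]

/-- The vertex set that picks the `v i`-th vertex of the `i`-th block of `m` vertices. -/
def tupleSet {s m : ℕ} (v : Fin s → Fin m) : Finset ℕ :=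
  Finset.univ.image fun i => (finProdFinEquiv (i, v i) : ℕ)

theorem tupleSet_card {s m : ℕ} (v : Fin s → Fin m) : (tupleSet v).card = s := by
  rw [tupleSet, Finset.card_image_of_injective, Finset.card_univ, Fintype.card_fin]
  intro i j h
  have := finProdFinEquiv.injective (Fin.ext h)
  exact congrArg Prod.fst this

theorem tupleSet_subset {s m : ℕ} (v : Fin s → Fin m) : tupleSet v ⊆ Finset.range (s * m) := by
  intro x hx
  obtain ⟨i, -, rfl⟩ := Finset.mem_image.1 hx
  exact Finset.mem_range.2 (Fin.is_lt _)

theorem tupleSet_inter_card {s m : ℕ} (v w : Fin s → Fin m) :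
    (tupleSet v ∩ tupleSet w).card = (Finset.univ.filter fun i => v i = w i).card := by
  have : tupleSet v ∩ tupleSet w
      = (Finset.univ.filter fun i => v i = w i).image fun i => (finProdFinEquiv (i, v i) : ℕ) := by
    ext x
    simp only [tupleSet, Finset.mem_inter, Finset.mem_image, Finset.mem_univ, true_and,
      Finset.mem_filter]
    constructor
    · rintro ⟨⟨i, rfl⟩, ⟨j, hj⟩⟩
      have h := finProdFinEquiv.injective (Fin.ext hj)
      obtain ⟨rfl, h2⟩ := Prod.mk.inj h
      exact ⟨_, h2.symm, rfl⟩
    · rintro ⟨i, hi, rfl⟩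
      exact ⟨⟨i, rfl⟩, ⟨i, by rw [hi]⟩⟩
  rw [this, Finset.card_image_of_injective]
  intro i j h
  exact congrArg Prod.fst (finProdFinEquiv.injective (Fin.ext h))

/-- Disjoint vertex sets span cliques independently. -/
theorem uniformModel_inter_of_disjoint {d k : ℕ} (hk : k ≤ d) {S S' : Finset ℕ}
    (h : Disjoint S S') :
    (uniformModel hk).real (cliqueEvent d S ∩ cliqueEvent d S')
      = cliqueProb d k S.card * cliqueProb d k S'.card := by
  have hind : ProbabilityTheory.iIndepFun (fun (i : ℕ) (f : ℕ → Subcube d) => f i)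
      (uniformModel hk) :=
    ProbabilityTheory.iIndepFun_infinitePi (X := fun _ c => c) fun _ => measurable_id
  have hi := hind.indepFun_finset S S' h fun i => measurable_pi_apply i
  have hm : ∀ T : Finset ℕ, MeasurableSet
      {c : T → Subcube d | IsCubeClique (T.subtype (· ∈ T)) c} := fun T =>
    (Set.toFinite _).measurableSet
  have := congrArg ENNReal.toReal (hi.measure_inter_preimage_eq_mul _ _ (hm S) (hm S'))
  rw [ENNReal.toReal_mul] at this
  rw [← uniformModel_cliqueEvent hk S, ← uniformModel_cliqueEvent hk S',
    cliqueEvent_eq d (subset_refl S), cliqueEvent_eq d (subset_refl S')]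
  exact this

theorem sum_pow_agreements {s m : ℕ} (t : ℝ) (v : Fin s → Fin m) :
    ∑ w : Fin s → Fin m, t ^ (Finset.univ.filter fun i => v i = w i).card = (m - 1 + t) ^ s := by
  have e : ∀ w : Fin s → Fin m, t ^ (Finset.univ.filter fun i => v i = w i).card
      = ∏ i, if v i = w i then t else 1 := by
    intro w
    rw [Finset.prod_ite, Finset.prod_const, Finset.prod_const_one, mul_one]
  simp only [e]
  rw [prod_sum_univ fun i a => if v i = a then t else 1]
  have h : ∀ i, ∑ a, (if v i = a then t else 1) = m - 1 + t := by
    intro i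
    have : ∀ a, (if v i = a then t else 1) = 1 + if v i = a then t - 1 else 0 := by
      intro a; split_ifs <;> ring
    simp only [this]
    rw [Finset.sum_add_distrib, Finset.sum_ite_eq]
    simp
    ring
  simp [h]

/-- The probability that the first `s * m` vertices contain no `s`-clique. -/
theorem uniformModel_no_clique_le {d k : ℕ} (hk : k ≤ d) {p : ℝ} (h0 : 0 < p) (h1 : p < 1)
    {s : ℕ} (hs : 1 ≤ s) {r : ℝ} (hr : 0 < r) (hrs : r ^ s = columnWeight s p)
    (hF : 0 < cliqueProb d k s) {m : ℕ} (hm : 0 < m) :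
    (uniformModel hk).real {f | ∀ v : Fin s → Fin m, f ∉ cliqueEvent d (tupleSet v)}
      ≤ ((r ^ d / binomialMass d k p) ^ s / cliqueProb d k s) ^ 2
        * ((1 + binomialMass d k p / r ^ d / m) ^ s - 1) := by
  set F := cliqueProb d k s with hFdef
  set B := binomialMass d k p with hB
  have hB0 : 0 < B := binomialMass_pos hk h0 h1
  set D := (r ^ d / B) ^ s with hD
  have hD0 : 0 < D := by positivity
  set ρ := B / r ^ d with hρ
  have hρ0 : 0 < ρ := by positivity
  have hm0 : (0 : ℝ) < m := by exact_mod_cast hm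
  have hmain := measureReal_no_event_le (μ := uniformModel hk)
    (fun v : Fin s → Fin m => cliqueEvent d (tupleSet v))
    (fun v => measurableSet_cliqueEvent d _) (F := F)
    (fun v => by rw [uniformModel_cliqueEvent, tupleSet_card])
    (fun v w => D ^ 2 * ((1 + ρ) ^ (Finset.univ.filter fun i => v i = w i).card - 1))
    (fun v w => by
      rcases Nat.eq_zero_or_pos (Finset.univ.filter fun i => v i = w i).card with h | h
      · have hdis : Disjoint (tupleSet v) (tupleSet w) := by
          rw [Finset.disjoint_iff_inter_eq_empty, ← Finset.card_eq_zero, tupleSet_inter_card, h]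
        rw [uniformModel_inter_of_disjoint hk hdis, tupleSet_card, tupleSet_card, h]
        simp [sq, hFdef]
      · have := uniformModel_inter_le hk h0 h1 hs hr.le hrs (tupleSet_card v) (tupleSet_card w)
        rw [tupleSet_inter_card] at this
        have hj : (Finset.univ.filter fun i => v i = w i).card ≤ s := by
          simpa using Finset.card_filter_le (Finset.univ : Finset (Fin s)) fun i => v i = w i
        set j := (Finset.univ.filter fun i => v i = w i).card
        have e1 : (r ^ d / B) ^ (2 * s - j) = D ^ 2 * ρ ^ j := by
          have : (r ^ d / B) ^ (2 * s) = (r ^ d / B) ^ (2 * s - j) * (r ^ d / B) ^ j := by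
            rw [← pow_add]; congr 1; omega
          have h3 : ρ ^ j * (r ^ d / B) ^ j = 1 := by
            rw [← mul_pow, hρ, div_mul_div_comm, mul_comm B, div_self (by positivity), one_pow]
          rw [hD, ← pow_mul, mul_comm s, this, mul_assoc, mul_comm (_ ^ j), h3, mul_one]
        have e2 : ρ ^ j ≤ (1 + ρ) ^ j - 1 := by
          have : (1 : ℝ) ^ j + ρ ^ j ≤ (1 + ρ) ^ j :=
            pow_add_pow_le zero_le_one hρ0.le (by omega)
          rw [one_pow] at this
          linarith
        calc _ ≤ _ := this
          _ = D ^ 2 * ρ ^ j := e1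
          _ ≤ D ^ 2 * ((1 + ρ) ^ j - 1) := by gcongr
          _ ≤ _ := by nlinarith [sq_nonneg F])
  have hsum : ∑ v : Fin s → Fin m, ∑ w : Fin s → Fin m,
      D ^ 2 * ((1 + ρ) ^ (Finset.univ.filter fun i => v i = w i).card - 1)
      = D ^ 2 * ((m : ℝ) ^ s * (m : ℝ) ^ s * ((1 + ρ / m) ^ s - 1)) := by
    have e1 : ∀ v : Fin s → Fin m, ∑ w : Fin s → Fin m,
        D ^ 2 * ((1 + ρ) ^ (Finset.univ.filter fun i => v i = w i).card - 1)
        = D ^ 2 * ((m : ℝ) ^ s * ((1 + ρ / m) ^ s - 1)) := by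
      intro v
      have e2 : (m : ℝ) * (1 + ρ / m) = m - 1 + (1 + ρ) := by field_simp; ring
      have e3 : (m : ℝ) ^ s * ((1 + ρ / m) ^ s - 1) = (m - 1 + (1 + ρ)) ^ s - (m : ℝ) ^ s := by
        rw [← e2, mul_pow]; ring
      rw [e3, ← Finset.mul_sum, Finset.sum_sub_distrib, sum_pow_agreements]
      simp
    simp only [e1]
    rw [Finset.sum_const, Finset.card_univ, nsmul_eq_mul]
    simp
    ring
  rw [hsum] at hmain
  have hcard : (Fintype.card (Fin s → Fin m) : ℝ) = (m : ℝ) ^ s := by simp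
  rw [hcard] at hmain
  have hpos : 0 < ((m : ℝ) ^ s * F) ^ 2 := by positivity
  rw [← le_div_iff₀ hpos] at hmain
  refine hmain.trans (le_of_eq ?_)
  field_simp

/-! ### Stochastic domination -/

/-- A function of a subcube that does not decrease when a coordinate is freed. -/
def CubeMono {d : ℕ} (G : Subcube d → ℝ) : Prop :=
  ∀ c i, G c ≤ G (Function.update c i none)

theorem dim_update_none {d : ℕ} {c : Subcube d} {i : Fin d} (h : c i ≠ none) :
    Subcube.dim (Function.update c i none) = c.dim + 1 := by
  have e : (Finset.univ.filter fun j => Function.update c i none j = none)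
      = insert i (Finset.univ.filter fun j => c j = none) := by
    ext j
    by_cases hj : j = i
    · subst hj; simp
    · simp [hj]
  unfold Subcube.dim
  rw [e, Finset.card_insert_of_notMem (by simpa using h)]

theorem card_ne_none {d : ℕ} (c : Subcube d) :
    (Finset.univ.filter fun i => c i ≠ none).card = d - c.dim := by
  unfold Subcube.dim
  rw [Finset.filter_not, Finset.card_sdiff]
  simp

/-- Double counting of the pairs of a `k`-dimensional and a `(k + 1)`-dimensional subcube, the
second of which arises from the first by freeing a coordinate. -/
theorem sum_dim_le_sum_dim_succ {d k : ℕ} {G : Subcube d → ℝ} (hG : CubeMono G) :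
    ((d - k : ℕ) : ℝ) * ∑ c ∈ subcubesOfDim d k, G c
      ≤ 2 * (k + 1) * ∑ c ∈ subcubesOfDim d (k + 1), G c := by
  have h1 : ((d - k : ℕ) : ℝ) * ∑ c ∈ subcubesOfDim d k, G c
      = ∑ x ∈ (subcubesOfDim d k).sigma fun c => Finset.univ.filter fun i => c i ≠ none, G x.1 := by
    rw [Finset.sum_sigma, Finset.mul_sum]
    refine Finset.sum_congr rfl fun c hc => ?_
    dsimp only
    rw [Finset.sum_const, card_ne_none, (Finset.mem_filter.1 hc).2, nsmul_eq_mul]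
  have h2 : 2 * ((k : ℝ) + 1) * ∑ c ∈ subcubesOfDim d (k + 1), G c
      = ∑ x ∈ (subcubesOfDim d (k + 1)).sigma fun c =>
          (Finset.univ.filter fun i => c i = none) ×ˢ (Finset.univ : Finset Bool), G x.1 := by
    rw [Finset.sum_sigma, Finset.mul_sum]
    refine Finset.sum_congr rfl fun c hc => ?_
    have := (Finset.mem_filter.1 hc).2
    unfold Subcube.dim at this
    dsimp only
    rw [Finset.sum_const, Finset.card_product, this, nsmul_eq_mul]
    push_cast [Finset.card_univ, Fintype.card_bool]
    ring
  rw [h1, h2]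
  calc _ ≤ ∑ x ∈ (subcubesOfDim d k).sigma fun c => Finset.univ.filter fun i => c i ≠ none,
        G (Function.update x.1 x.2 none) := Finset.sum_le_sum fun x _ => hG _ _
    _ = _ := by
      refine Finset.sum_bij'
        (fun x _ => ⟨Function.update x.1 x.2 none, (x.2, (x.1 x.2).getD false)⟩)
        (fun y _ => ⟨Function.update y.1 y.2.1 (some y.2.2), y.2.1⟩) ?_ ?_ ?_ ?_ ?_
      · rintro ⟨c, i⟩ hx
        simp only [Finset.mem_sigma, subcubesOfDim, Finset.mem_filter, Finset.mem_univ,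
          true_and] at hx
        simp [subcubesOfDim, dim_update_none hx.2, hx.1]
      · rintro ⟨c, i, b⟩ hy
        simp only [Finset.mem_sigma, subcubesOfDim, Finset.mem_filter, Finset.mem_univ,
          true_and, Finset.mem_product, and_true] at hy
        have := dim_update_none (c := Function.update c i (some b)) (i := i) (by simp)
        rw [Function.update_idem, ← hy.2, Function.update_eq_self, hy.1] at this
        simp only [Finset.mem_sigma, subcubesOfDim, Finset.mem_filter, Finset.mem_univ, true_and]
        exact ⟨by omega, by simp⟩
      · rintro ⟨c, i⟩ hx
        simp only [Finset.mem_sigma, subcubesOfDim, Finset.mem_filter, Finset.mem_univ,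
          true_and] at hx
        obtain ⟨b, hb⟩ := Option.ne_none_iff_exists'.1 hx.2
        have : Function.update c i (some b) = c := by rw [← hb, Function.update_eq_self]
        simp [hb, this]
      · rintro ⟨c, i, b⟩ hy
        simp only [Finset.mem_sigma, subcubesOfDim, Finset.mem_filter, Finset.mem_univ,
          true_and, Finset.mem_product, and_true] at hy
        have : Function.update c i none = c := by rw [← hy.2, Function.update_eq_self]
        simp [this]
      · rintro ⟨c, i⟩ _
        rfl

theorem sum_unifWeight_mul (d k : ℕ) (G : Subcube d → ℝ) :
    ∑ c, unifWeight d k c * G c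
      = ((subcubesOfDim d k).card : ℝ)⁻¹ * ∑ c ∈ subcubesOfDim d k, G c := by
  simp only [unifWeight, subcubesOfDim, ite_mul, zero_mul]
  rw [← Finset.sum_filter, Finset.mul_sum]

/-- A uniformly random subcube is stochastically increasing in its dimension. -/
theorem sum_unifWeight_mono {d k l : ℕ} (hkl : k ≤ l) (hl : l ≤ d) {G : Subcube d → ℝ}
    (hG : CubeMono G) : ∑ c, unifWeight d k c * G c ≤ ∑ c, unifWeight d l c * G c := by
  induction l, hkl using Nat.le_induction with
  | base => exact le_rfl
  | succ l hkl ih =>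
    refine (ih (by omega)).trans ?_
    rw [sum_unifWeight_mul, sum_unifWeight_mul]
    have h0 := (subcubesOfDim_nonempty (show l ≤ d by omega)).card_pos
    have h1 := (subcubesOfDim_nonempty hl).card_pos
    have hc : (subcubesOfDim d l).card * (d - l) = 2 * (l + 1) * (subcubesOfDim d (l + 1)).card := by
      have e : d - l = (d - (l + 1)) + 1 := by omega
      have hch := Nat.choose_succ_right_eq d l
      rw [card_subcubesOfDim, card_subcubesOfDim]
      calc d.choose l * 2 ^ (d - l) * (d - l) = d.choose l * (d - l) * 2 ^ (d - l) := by ring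
        _ = d.choose (l + 1) * (l + 1) * 2 ^ (d - l) := by rw [hch]
        _ = d.choose (l + 1) * (l + 1) * (2 ^ (d - (l + 1)) * 2) := by rw [← pow_succ, ← e]
        _ = _ := by ring
    have hs := sum_dim_le_sum_dim_succ (k := l) hG
    have hcR : ((subcubesOfDim d l).card : ℝ) * ((d - l : ℕ) : ℝ)
        = 2 * (l + 1) * (subcubesOfDim d (l + 1)).card := by exact_mod_cast hc
    have h0R : (0 : ℝ) < (subcubesOfDim d l).card := by exact_mod_cast h0
    have h1R : (0 : ℝ) < (subcubesOfDim d (l + 1)).card := by exact_mod_cast h1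
    have hdl : (0 : ℝ) < ((d - l : ℕ) : ℝ) := by
      have : 0 < d - l := by omega
      exact_mod_cast this
    rw [inv_mul_le_iff₀ h0R, ← mul_assoc, ← div_eq_mul_inv, div_mul_eq_mul_div, le_div_iff₀ h1R]
    refine le_of_mul_le_mul_left ?_ (show (0 : ℝ) < 2 * (l + 1) by positivity)
    calc 2 * ((l : ℝ) + 1) * ((∑ c ∈ subcubesOfDim d l, G c) * (subcubesOfDim d (l + 1)).card)
        = (subcubesOfDim d l).card * (((d - l : ℕ) : ℝ) * ∑ c ∈ subcubesOfDim d l, G c) := by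
          linear_combination -(∑ c ∈ subcubesOfDim d l, G c) * hcR
      _ ≤ (subcubesOfDim d l).card * (2 * (l + 1) * ∑ c ∈ subcubesOfDim d (l + 1), G c) :=
          mul_le_mul_of_nonneg_left hs h0R.le
      _ = _ := by ring

theorem sum_fin_cons {X : Type*} [Fintype X] {s : ℕ} (f : (Fin (s + 1) → X) → ℝ) :
    ∑ c, f c = ∑ x, ∑ v : Fin s → X, f (Fin.cons x v) := by
  rw [← Fintype.sum_prod_type']
  exact (Fintype.sum_equiv (Fin.consEquiv fun _ => X) _ _ fun _ => rfl).symm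

/-- Stochastic domination between weights passes to product weights. -/
theorem sum_prod_mono {d : ℕ} {ν ν' : Subcube d → ℝ} (hν : ∀ c, 0 ≤ ν c) (hν' : ∀ c, 0 ≤ ν' c)
    (hdom : ∀ G : Subcube d → ℝ, CubeMono G → ∑ c, ν c * G c ≤ ∑ c, ν' c * G c) (s : ℕ)
    (Φ : (Fin s → Subcube d) → ℝ)
    (hΦ : ∀ c u i, Φ c ≤ Φ (Function.update c u (Function.update (c u) i none))) :
    ∑ c, (∏ u, ν (c u)) * Φ c ≤ ∑ c, (∏ u, ν' (c u)) * Φ c := by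
  induction s with
  | zero => simp
  | succ s ih =>
    rw [sum_fin_cons, sum_fin_cons]
    simp only [Fin.prod_univ_succ, Fin.cons_zero, Fin.cons_succ, mul_assoc]
    calc ∑ x, ∑ v : Fin s → Subcube d, ν x * ((∏ u, ν (v u)) * Φ (Fin.cons x v))
        ≤ ∑ x, ∑ v : Fin s → Subcube d, ν x * ((∏ u, ν' (v u)) * Φ (Fin.cons x v)) := by
          refine Finset.sum_le_sum fun x _ => ?_
          rw [← Finset.mul_sum, ← Finset.mul_sum]
          refine mul_le_mul_of_nonneg_left (ih (fun v => Φ (Fin.cons x v)) fun v u i => ?_) (hν x)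
          have := hΦ (Fin.cons x v) u.succ i
          rwa [← Fin.cons_update, Fin.cons_succ] at this
      _ = ∑ v : Fin s → Subcube d, (∏ u, ν' (v u)) * ∑ x, ν x * Φ (Fin.cons x v) := by
          rw [Finset.sum_comm]
          refine Finset.sum_congr rfl fun v _ => ?_
          rw [Finset.mul_sum]
          exact Finset.sum_congr rfl fun x _ => by ring
      _ ≤ ∑ v : Fin s → Subcube d, (∏ u, ν' (v u)) * ∑ x, ν' x * Φ (Fin.cons x v) := by
          refine Finset.sum_le_sum fun v _ => mul_le_mul_of_nonneg_left
            (hdom (fun x => Φ (Fin.cons x v)) fun x i => ?_)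
            (Finset.prod_nonneg fun u _ => hν' _)
          have := hΦ (Fin.cons x v) 0 i
          rwa [Fin.update_cons_zero, Fin.cons_zero] at this
      _ = _ := by
          rw [Finset.sum_comm]
          refine Finset.sum_congr rfl fun v _ => ?_
          rw [Finset.mul_sum]
          exact Finset.sum_congr rfl fun x _ => by ring

theorem isCubeClique_update {d s : ℕ} {c : Fin s → Subcube d} (u : Fin s) (i : Fin d)
    (h : IsCubeClique Finset.univ c) :
    IsCubeClique Finset.univ (Function.update c u (Function.update (c u) i none)) := by
  have key : ∀ v l, Function.update c u (Function.update (c u) i none) v l = none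
      ∨ Function.update c u (Function.update (c u) i none) v l = c v l := by
    intro v l
    by_cases hv : v = u
    · subst hv
      by_cases hl : l = i
      · subst hl; simp
      · simp [hl]
    · simp [hv]
  intro l v hv w hw
  simp only
  rcases key v l with h1 | h1
  · exact Or.inl h1
  rcases key w l with h2 | h2
  · exact Or.inr (Or.inl h2)
  rw [h1, h2]
  exact h l v hv w hw

/-! ### The lower bound for the clique probability -/

/-- The binomial weight of a subcube whose dimension lies in `[lo, k]`. -/
noncomputable def windowWeight {d : ℕ} (p : ℝ) (lo k : ℕ) (c : Subcube d) : ℝ :=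
  if lo ≤ c.dim ∧ c.dim ≤ k then ∏ i, symWeight p (c i) else 0

theorem windowWeight_eq {d k : ℕ} (hk : k ≤ d) (p : ℝ) (lo : ℕ) (c : Subcube d) :
    windowWeight p lo k c = ∑ j ∈ Finset.Icc lo k, binomialMass d j p * unifWeight d j c := by
  have : ∀ j ∈ Finset.Icc lo k, binomialMass d j p * unifWeight d j c
      = if c.dim = j then ∏ i, symWeight p (c i) else 0 := by
    intro j hj
    rw [mul_comm, unifWeight_mul_binomialMass ((Finset.mem_Icc.1 hj).2.trans hk)]
  rw [Finset.sum_congr rfl this, Finset.sum_ite_eq, windowWeight]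
  simp only [Finset.mem_Icc]

theorem sum_windowWeight_le {d k : ℕ} (hk : k ≤ d) {p : ℝ} (h0 : 0 < p) (h1 : p < 1) (lo s : ℕ) :
    ∑ c : Fin s → Subcube d, (∏ u, windowWeight p lo k (c u)) * ind (IsCubeClique Finset.univ c)
      ≤ (∑ j ∈ Finset.Icc lo k, binomialMass d j p) ^ s * cliqueProb d k s := by
  set τ := ∑ j ∈ Finset.Icc lo k, binomialMass d j p
  have hmass : ∀ j ∈ Finset.Icc lo k, 0 ≤ binomialMass d j p := fun j hj =>
    (binomialMass_pos ((Finset.mem_Icc.1 hj).2.trans hk) h0 h1).le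
  have hτ : 0 ≤ τ := Finset.sum_nonneg hmass
  have hdom : ∀ G : Subcube d → ℝ, CubeMono G →
      ∑ c, windowWeight p lo k c * G c ≤ ∑ c, (τ * unifWeight d k c) * G c := by
    intro G hG
    simp only [windowWeight_eq hk, Finset.sum_mul, mul_assoc, τ]
    rw [Finset.sum_comm, Finset.sum_comm (s := (Finset.univ : Finset (Subcube d)))]
    refine Finset.sum_le_sum fun j hj => ?_
    rw [← Finset.mul_sum, ← Finset.mul_sum]
    exact mul_le_mul_of_nonneg_left (sum_unifWeight_mono (Finset.mem_Icc.1 hj).2 hk hG)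
      (hmass j hj)
  refine (sum_prod_mono (ν' := fun c => τ * unifWeight d k c) ?_ ?_ hdom s
    (fun c => ind (IsCubeClique Finset.univ c)) ?_).trans (le_of_eq ?_)
  · intro c
    unfold windowWeight
    split_ifs
    · exact Finset.prod_nonneg fun i _ => symWeight_nonneg h0.le h1.le _
    · exact le_rfl
  · exact fun c => mul_nonneg hτ (unifWeight_nonneg _ _ _)
  · exact fun c u i => ind_mono (isCubeClique_update u i)
  · rw [cliqueProb, Finset.mul_sum]
    refine Finset.sum_congr rfl fun c _ => ?_
    rw [Finset.prod_mul_distrib, Finset.prod_const, Finset.card_univ, Fintype.card_fin, mul_assoc]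

/-- The exponential Markov inequality for the upper tail of a binomial distribution. -/
theorem sum_binomialMass_le {d k lo : ℕ} (hk : k ≤ d) {p : ℝ} (h0 : 0 < p) (h1 : p < 1)
    {l β : ℝ} (hl : 1 ≤ l) (hlo : β * d ≤ lo) :
    ∑ j ∈ Finset.Icc lo k, binomialMass d j p ≤ ((1 - p + p * l) / l ^ β) ^ d := by
  have hl0 : 0 < l := by linarith
  have hb : 0 < l ^ β := Real.rpow_pos_of_pos hl0 _
  have hp : 0 < 1 - p := by linarith
  rw [div_pow, le_div_iff₀ (pow_pos hb d), Finset.sum_mul]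
  calc ∑ j ∈ Finset.Icc lo k, binomialMass d j p * (l ^ β) ^ d
      ≤ ∑ j ∈ Finset.Icc lo k, binomialMass d j p * l ^ j := by
        refine Finset.sum_le_sum fun j hj => ?_
        rw [Finset.mem_Icc] at hj
        refine mul_le_mul_of_nonneg_left ?_ (binomialMass_pos (hj.2.trans hk) h0 h1).le
        rw [← Real.rpow_natCast, ← Real.rpow_mul hl0.le, ← Real.rpow_natCast]
        refine Real.rpow_le_rpow_of_exponent_le hl (hlo.trans ?_)
        exact_mod_cast hj.1
    _ ≤ ∑ j ∈ Finset.range (d + 1), binomialMass d j p * l ^ j := by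
        refine Finset.sum_le_sum_of_subset_of_nonneg (fun j hj => ?_) fun j hj _ => ?_
        · rw [Finset.mem_Icc] at hj
          rw [Finset.mem_range]
          omega
        · unfold binomialMass
          positivity
    _ = (1 - p + p * l) ^ d := by
        rw [add_comm (1 - p), add_pow]
        refine Finset.sum_congr rfl fun j _ => ?_
        rw [binomialMass, mul_pow]
        ring

theorem sum_famWeight_tail_le {s d : ℕ} {p : ℝ} (h0 : 0 < p) (h1 : p < 1) (u : Fin s)
    {t a : ℝ} (ht : 0 < t) (P : ℕ → Prop) (hP : ∀ j, P j → t ^ (a * d) ≤ t ^ j) :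
    ∑ c : Fin s → Subcube d, famWeight p c * ind (IsCubeClique Finset.univ c) * ind (P (c u).dim)
      ≤ columnWeight s p ^ d * ((1 - alphaS s p + alphaS s p * t) / t ^ a) ^ d := by
  have hta : 0 < t ^ a := Real.rpow_pos_of_pos ht _
  have := sum_famWeight_tilted (ι := Fin s) d h0.le h1.le t u
  rw [Fintype.card_fin] at this
  rw [div_pow, ← mul_div_assoc, ← this, le_div_iff₀ (pow_pos hta d), Finset.sum_mul]
  refine Finset.sum_le_sum fun c _ => ?_
  rw [mul_assoc]
  refine mul_le_mul_of_nonneg_left ?_ (mul_nonneg (famWeight_nonneg h0.le h1.le c) (ind_nonneg _))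
  by_cases h : P (c u).dim
  · rw [ind_of h, one_mul, ← Real.rpow_natCast, ← Real.rpow_mul ht.le]
    exact hP _ h
  · rw [ind_of_not h, zero_mul]
    positivity

theorem hasDerivAt_tilt (a r : ℝ) :
    HasDerivAt (fun t : ℝ => t ^ a - (1 - r + r * t)) (a - r) 1 := by
  have h1 : HasDerivAt (fun t : ℝ => t ^ a) a 1 := by
    simpa using Real.hasDerivAt_rpow_const (x := (1 : ℝ)) (p := a) (Or.inl one_ne_zero)
  have h2 : HasDerivAt (fun t : ℝ => 1 - r + r * t) r 1 := by
    simpa using ((hasDerivAt_id (1 : ℝ)).const_mul r).const_add (1 - r)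
  exact h1.sub h2

/-- To first order at `t = 1` the function `t ^ a` grows with slope `a` and `1 - r + r t` with
slope `r`. -/
theorem exists_tilt_gt {a r : ℝ} (h : r < a) : ∃ t : ℝ, 1 < t ∧ 1 - r + r * t < t ^ a := by
  have hs := (hasDerivAt_tilt a r).tendsto_slope.mono_left
    (nhdsWithin_mono (1 : ℝ) (show Set.Ioi (1 : ℝ) ⊆ {1}ᶜ from fun x hx => ne_of_gt hx))
  have := (hs.eventually (lt_mem_nhds (sub_pos.2 h))).and self_mem_nhdsWithin
  obtain ⟨t, ht, ht1⟩ := this.exists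
  refine ⟨t, ht1, ?_⟩
  rw [slope_def_field] at ht
  have := (div_pos_iff_of_pos_right (sub_pos.2 ht1)).1 ht
  simp at this
  linarith

theorem exists_tilt_lt {a r : ℝ} (h : a < r) :
    ∃ t : ℝ, 0 < t ∧ t < 1 ∧ 1 - r + r * t < t ^ a := by
  have hs := (hasDerivAt_tilt a r).tendsto_slope.mono_left
    (nhdsWithin_mono (1 : ℝ) (show Set.Iio (1 : ℝ) ⊆ {1}ᶜ from fun x hx => ne_of_lt hx))
  have := ((hs.eventually (gt_mem_nhds (sub_neg.2 h))).and self_mem_nhdsWithin).and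
    (mem_nhdsWithin_of_mem_nhds (lt_mem_nhds one_pos))
  obtain ⟨t, ⟨ht, ht1⟩, ht0⟩ := this.exists
  refine ⟨t, ht0, ht1, ?_⟩
  rw [slope_def_field] at ht
  rcases div_neg_iff.1 ht with ⟨h1, -⟩ | ⟨-, h2⟩
  · simp at h1
    linarith
  · linarith [show t < 1 from ht1]

/-- If the typical fraction of wildcards in a binomial clique of parameter `p` lies between `β` and
`α`, then the clique probability of the uniform model is bounded below by the weight of the
binomial cliques, divided by the probability that `s` binomial variables exceed `β d`. -/
theorem eventually_le_cliqueProb {α : ℝ} (hα : α ∈ Set.Icc (0 : ℝ) 1) {s : ℕ} (hs : 1 ≤ s)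
    {p β l : ℝ} (h0 : 0 < p) (h1 : p < 1) (hβ : β < alphaS s p) (hpα : alphaS s p < α) (hl : 1 ≤ l) :
    ∀ᶠ d : ℕ in atTop, 1 / 2 * (columnWeight s p * (l ^ β / (1 - p + p * l)) ^ s) ^ d
      ≤ cliqueProb d ⌊α * d⌋₊ s := by
  obtain ⟨t, ht1, ht⟩ := exists_tilt_gt hpα
  obtain ⟨t', ht0', ht1', ht'⟩ := exists_tilt_lt hβ
  have ht0 : 0 < t := by linarith
  set r := alphaS s p with hr
  have hr0 : 0 < r := alphaS_pos h0 h1.le s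
  have hr1 : r < 1 := alphaS_lt_one h0.le h1 hs
  have hq := columnWeight_pos h0.le h1.le s
  set θ := (1 - r + r * t) / t ^ α
  set θ' := (1 - r + r * t') / t' ^ β
  have hta : 0 < t ^ α := Real.rpow_pos_of_pos ht0 _
  have hta' : 0 < t' ^ β := Real.rpow_pos_of_pos ht0' _
  have hθ0 : 0 ≤ θ := div_nonneg (by nlinarith) hta.le
  have hθ0' : 0 ≤ θ' := div_nonneg (by nlinarith) hta'.le
  have hθ1 : θ < 1 := (div_lt_one hta).2 ht
  have hθ1' : θ' < 1 := (div_lt_one hta').2 ht'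
  have hlim : Tendsto (fun d : ℕ => (s : ℝ) * (θ ^ d + θ' ^ d)) atTop (𝓝 0) := by
    simpa using ((tendsto_pow_atTop_nhds_zero_of_lt_one hθ0 hθ1).add
      (tendsto_pow_atTop_nhds_zero_of_lt_one hθ0' hθ1')).const_mul (s : ℝ)
  filter_upwards [hlim.eventually (gt_mem_nhds (show (0 : ℝ) < 1 / 2 by norm_num))] with d hd
  set k := ⌊α * d⌋₊ with hk
  have hkd : k ≤ d := floor_mul_le hα d
  set lo := ⌈β * d⌉₊ with hlo
  have hwin := sum_windowWeight_le hkd h0 h1 lo s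
  have htail := sum_binomialMass_le (k := k) (lo := lo) hkd h0 h1 hl (Nat.le_ceil (β * d))
  have hlow : columnWeight s p ^ d - ∑ _u : Fin s, columnWeight s p ^ d * (θ ^ d + θ' ^ d)
      ≤ ∑ c : Fin s → Subcube d, (∏ u, windowWeight p lo k (c u))
        * ind (IsCubeClique Finset.univ c) := by
    have : Nonempty (Fin s) := ⟨⟨0, hs⟩⟩
    have htot := sum_famWeight_clique (ι := Fin s) d h0.le h1.le
    rw [Fintype.card_fin] at htot
    have hu : ∀ u : Fin s, ∑ c : Fin s → Subcube d, famWeight p c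
          * ind (IsCubeClique Finset.univ c) * (ind (k < (c u).dim) + ind ((c u).dim < lo))
        ≤ columnWeight s p ^ d * (θ ^ d + θ' ^ d) := by
      intro u
      simp only [mul_add, Finset.sum_add_distrib]
      refine add_le_add (sum_famWeight_tail_le h0 h1 u ht0 (fun j => k < j) fun j hj => ?_)
        (sum_famWeight_tail_le h0 h1 u ht0' (fun j => j < lo) fun j hj => ?_)
      · rw [← Real.rpow_natCast]
        refine Real.rpow_le_rpow_of_exponent_le ht1.le ?_
        have := Nat.lt_floor_add_one (α * d)
        have hj' : (k : ℝ) + 1 ≤ j := by exact_mod_cast hj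
        linarith
      · rw [← Real.rpow_natCast]
        refine Real.rpow_le_rpow_of_exponent_ge ht0' ht1'.le ?_
        exact (Nat.lt_ceil.1 hj).le
    calc _ ≤ ∑ c : Fin s → Subcube d, famWeight p c * ind (IsCubeClique Finset.univ c)
          - ∑ u : Fin s, ∑ c : Fin s → Subcube d, famWeight p c
          * ind (IsCubeClique Finset.univ c) * (ind (k < (c u).dim) + ind ((c u).dim < lo)) := by
          rw [htot]
          exact sub_le_sub_left (Finset.sum_le_sum fun u _ => hu u) _
      _ = ∑ c : Fin s → Subcube d, famWeight p c * ind (IsCubeClique Finset.univ c)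
          * (1 - ∑ u : Fin s, (ind (k < (c u).dim) + ind ((c u).dim < lo))) := by
          rw [Finset.sum_comm, ← Finset.sum_sub_distrib]
          refine Finset.sum_congr rfl fun c _ => ?_
          rw [← Finset.mul_sum]
          ring
      _ ≤ _ := by
          refine Finset.sum_le_sum fun c _ => ?_
          rw [mul_right_comm]
          refine mul_le_mul_of_nonneg_right ?_ (ind_nonneg _)
          have hf := famWeight_nonneg h0.le h1.le c
          have hsn : ∀ u : Fin s, 0 ≤ ind (k < (c u).dim) + ind ((c u).dim < lo) := fun u =>
            add_nonneg (ind_nonneg _) (ind_nonneg _)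
          by_cases hall : ∀ u, lo ≤ (c u).dim ∧ (c u).dim ≤ k
          · have e : ∏ u, windowWeight p lo k (c u) = famWeight p c :=
              Finset.prod_congr rfl fun u _ => if_pos (hall u)
            rw [e]
            refine mul_le_of_le_one_right hf ?_
            have := Finset.sum_nonneg fun u (_ : u ∈ Finset.univ) => hsn u
            linarith
          · have hw : 0 ≤ ∏ u, windowWeight p lo k (c u) := by
              refine Finset.prod_nonneg fun u _ => ?_
              unfold windowWeight
              split_ifs
              · exact Finset.prod_nonneg fun i _ => symWeight_nonneg h0.le h1.le _
              · exact le_rfl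
            refine le_trans (mul_nonpos_of_nonneg_of_nonpos hf ?_) hw
            push Not at hall
            obtain ⟨u, hu⟩ := hall
            have h2 := Finset.single_le_sum (fun u _ => hsn u) (Finset.mem_univ u)
            have h3 : 1 ≤ ind (k < (c u).dim) + ind ((c u).dim < lo) := by
              by_cases h : lo ≤ (c u).dim
              · rw [ind_of (hu h)]; linarith [ind_nonneg ((c u).dim < lo)]
              · rw [ind_of (not_le.1 h)]; linarith [ind_nonneg (k < (c u).dim)]
            linarith
  rw [Finset.sum_const, Finset.card_univ, Fintype.card_fin, nsmul_eq_mul] at hlow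
  have hqd : 0 < columnWeight s p ^ d := pow_pos hq d
  have hden : 0 < 1 - p + p * l := by nlinarith
  have hlb : 0 < l ^ β := Real.rpow_pos_of_pos (by linarith) _
  have hFn := cliqueProb_nonneg d k s
  have hτ0 : 0 ≤ ∑ j ∈ Finset.Icc lo k, binomialMass d j p := Finset.sum_nonneg fun j hj =>
    (binomialMass_pos ((Finset.mem_Icc.1 hj).2.trans hkd) h0 h1).le
  have hchain : columnWeight s p ^ d / 2
      ≤ (((1 - p + p * l) / l ^ β) ^ d) ^ s * cliqueProb d k s := by
    calc columnWeight s p ^ d / 2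
        ≤ columnWeight s p ^ d - s * (columnWeight s p ^ d * (θ ^ d + θ' ^ d)) := by nlinarith
      _ ≤ _ := hlow
      _ ≤ _ := hwin
      _ ≤ _ := mul_le_mul_of_nonneg_right (pow_le_pow_left₀ hτ0 htail s) hFn
  have e : (columnWeight s p * (l ^ β / (1 - p + p * l)) ^ s) ^ d
      = columnWeight s p ^ d / (((1 - p + p * l) / l ^ β) ^ d) ^ s := by
    rw [mul_pow, ← pow_mul, ← pow_mul, mul_comm d s, div_pow, div_pow]
    field_simp
  rw [e, ← mul_div_assoc, div_le_iff₀ (by positivity)]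
  linarith

/-! ### The binomial point mass -/

theorem factorial_mul_pow_le (k i : ℕ) : k.factorial * k ^ i ≤ i.factorial * k ^ k := by
  rcases le_total k i with h | h
  · have h1 := Nat.factorial_mul_pow_sub_le_factorial h
    calc k.factorial * k ^ i = k.factorial * k ^ (i - k) * k ^ k := by
          rw [mul_assoc, ← pow_add, Nat.sub_add_cancel h]
      _ ≤ _ := Nat.mul_le_mul_right _ h1
  · have h1 := Nat.factorial_mul_descFactorial (Nat.sub_le k i)
    rw [Nat.sub_sub_self h] at h1
    calc k.factorial * k ^ i = i.factorial * k.descFactorial (k - i) * k ^ i := by rw [h1]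
      _ ≤ i.factorial * k ^ (k - i) * k ^ i :=
          Nat.mul_le_mul_right _ (Nat.mul_le_mul_left _ (Nat.descFactorial_le_pow k _))
      _ = _ := by rw [mul_assoc, ← pow_add, Nat.sub_add_cancel h]

/-- The term with index `k` is the largest in the binomial expansion of `(k + (d - k)) ^ d`. -/
theorem choose_mul_pow_le {d k i : ℕ} (hk : k ≤ d) (hi : i ≤ d) :
    d.choose i * k ^ i * (d - k) ^ (d - i) ≤ d.choose k * k ^ k * (d - k) ^ (d - k) := by
  have h1 := factorial_mul_pow_le k i
  have h2 := factorial_mul_pow_le (d - k) (d - i)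
  have e1 := Nat.choose_mul_factorial_mul_factorial hk
  have e2 := Nat.choose_mul_factorial_mul_factorial hi
  refine Nat.le_of_mul_le_mul_right ?_
    (Nat.mul_pos k.factorial_pos (d - k).factorial_pos)
  calc d.choose i * k ^ i * (d - k) ^ (d - i) * (k.factorial * (d - k).factorial)
      = d.choose i * ((k.factorial * k ^ i) * ((d - k).factorial * (d - k) ^ (d - i))) := by ring
    _ ≤ d.choose i * ((i.factorial * k ^ k) * ((d - i).factorial * (d - k) ^ (d - k))) :=
        Nat.mul_le_mul_left _ (Nat.mul_le_mul h1 h2)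
    _ = d.choose i * i.factorial * (d - i).factorial * (k ^ k * (d - k) ^ (d - k)) := by ring
    _ = d.choose k * k.factorial * (d - k).factorial * (k ^ k * (d - k) ^ (d - k)) := by
        rw [e1, e2]
    _ = _ := by ring

theorem pow_self_le_succ_mul {d k : ℕ} (hk : k ≤ d) :
    d ^ d ≤ (d + 1) * (d.choose k * k ^ k * (d - k) ^ (d - k)) := by
  calc d ^ d = (k + (d - k)) ^ d := by rw [Nat.add_sub_cancel' hk]
    _ = ∑ i ∈ Finset.range (d + 1), d.choose i * k ^ i * (d - k) ^ (d - i) := by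
        rw [add_pow]
        exact Finset.sum_congr rfl fun i _ => by simp only [Nat.cast_id]; ring
    _ ≤ ∑ i ∈ Finset.range (d + 1), d.choose k * k ^ k * (d - k) ^ (d - k) :=
        Finset.sum_le_sum fun i hi => choose_mul_pow_le hk (by
          rw [Finset.mem_range] at hi; omega)
    _ = _ := by simp

/-- The negative of the relative entropy of the Bernoulli distribution with parameter `x` with
respect to the one with parameter `p`. -/
noncomputable def negRelEntropy (p x : ℝ) : ℝ :=
  x * Real.log (p / x) + (1 - x) * Real.log ((1 - p) / (1 - x))

theorem exp_negRelEntropy_le {d k : ℕ} (hk0 : 0 < k) (hkd : k < d) {p : ℝ} (h0 : 0 < p)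
    (h1 : p < 1) :
    Real.exp (d * negRelEntropy p (k / d)) ≤ (d + 1) * binomialMass d k p := by
  have hk : (0 : ℝ) < k := by exact_mod_cast hk0
  have hd : (0 : ℝ) < d := by exact_mod_cast hk0.trans hkd
  have hm : (0 : ℝ) < ((d - k : ℕ) : ℝ) := by exact_mod_cast Nat.sub_pos_of_lt hkd
  have hp : 0 < 1 - p := by linarith
  have hmR : ((d - k : ℕ) : ℝ) = d - k := Nat.cast_sub hkd.le
  have e1 : (d : ℝ) * negRelEntropy p (k / d)
      = k * Real.log (p * d / k) + ((d - k : ℕ) : ℝ) * Real.log ((1 - p) * d / (d - k : ℕ)) := by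
    have a1 : p / ((k : ℝ) / d) = p * d / k := by field_simp
    have a2 : (1 - p) / (1 - (k : ℝ) / d) = (1 - p) * d / (d - k : ℕ) := by
      rw [hmR, one_sub_div hd.ne']
      field_simp
    rw [negRelEntropy, a1, a2, hmR]
    field_simp
  have e2 : Real.exp (d * negRelEntropy p (k / d))
      = (p * d / k) ^ k * ((1 - p) * d / (d - k : ℕ)) ^ (d - k) := by
    rw [e1, Real.exp_add, Real.exp_nat_mul, Real.exp_nat_mul, Real.exp_log (by positivity),
      Real.exp_log (by positivity)]
  have hmax : ((d : ℝ)) ^ d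
      ≤ (d + 1) * (d.choose k * (k : ℝ) ^ k * ((d - k : ℕ) : ℝ) ^ (d - k)) := by
    exact_mod_cast pow_self_le_succ_mul hkd.le
  have e3 : (p * d / k) ^ k * ((1 - p) * d / (d - k : ℕ)) ^ (d - k)
      = p ^ k * (1 - p) ^ (d - k) / ((k : ℝ) ^ k * ((d - k : ℕ) : ℝ) ^ (d - k)) * (d : ℝ) ^ d := by
    have : (d : ℝ) ^ d = (d : ℝ) ^ k * (d : ℝ) ^ (d - k) := by
      rw [← pow_add, Nat.add_sub_cancel' hkd.le]
    rw [this, div_pow, div_pow, mul_pow, mul_pow]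
    field_simp
  rw [e2, e3]
  calc _ ≤ p ^ k * (1 - p) ^ (d - k) / ((k : ℝ) ^ k * ((d - k : ℕ) : ℝ) ^ (d - k))
        * ((d + 1) * (d.choose k * (k : ℝ) ^ k * ((d - k : ℕ) : ℝ) ^ (d - k))) := by gcongr
    _ = _ := by
        rw [binomialMass]
        field_simp

theorem eventually_exp_le_binomialMass {α : ℝ} (hα : α ∈ Set.Ioo (0 : ℝ) 1) {p : ℝ} (h0 : 0 < p)
    (h1 : p < 1) {η : ℝ} (hη : 0 < η) :
    ∀ᶠ d : ℕ in atTop, Real.exp (d * (negRelEntropy p α - η)) ≤ binomialMass d ⌊α * d⌋₊ p := by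
  have hp : 0 < 1 - p := by linarith
  have hlim : Tendsto (fun d : ℕ => (⌊α * d⌋₊ : ℝ) / d) atTop (𝓝 α) :=
    (tendsto_nat_floor_mul_div_atTop hα.1.le).comp tendsto_natCast_atTop_atTop
  have hcont : ContinuousAt (negRelEntropy p) α := by
    unfold negRelEntropy
    have ha : α ≠ 0 := hα.1.ne'
    have ha' : 1 - α ≠ 0 := by linarith [hα.2]
    refine (continuousAt_id.mul (ContinuousAt.log (by fun_prop (disch := assumption)) ?_)).add
      (ContinuousAt.mul (by fun_prop) (ContinuousAt.log (by fun_prop (disch := assumption)) ?_))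
    · exact div_ne_zero h0.ne' ha
    · exact div_ne_zero hp.ne' ha'
  have hent := (hcont.tendsto.comp hlim).eventually
    (lt_mem_nhds (show negRelEntropy p α - η / 2 < negRelEntropy p α by linarith))
  have hpoly : Tendsto (fun d : ℕ => ((d : ℝ) + 1) * Real.exp (-(η / 2)) ^ d) atTop (𝓝 0) := by
    have hlt : Real.exp (-(η / 2)) < 1 := Real.exp_lt_one_iff.2 (by linarith)
    have t1 := tendsto_self_mul_const_pow_of_lt_one (Real.exp_pos (-(η / 2))).le hlt
    have t2 := tendsto_pow_atTop_nhds_zero_of_lt_one (Real.exp_pos (-(η / 2))).le hlt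
    simpa [add_mul] using t1.add t2
  filter_upwards [hent, hpoly.eventually (gt_mem_nhds one_pos),
    hlim.eventually (lt_mem_nhds hα.1), hlim.eventually (gt_mem_nhds hα.2),
    eventually_gt_atTop 0] with d hd1 hd2 hd3 hd4 hd5
  have hd : (0 : ℝ) < d := by exact_mod_cast hd5
  have hk0 : 0 < ⌊α * d⌋₊ := by
    rcases Nat.eq_zero_or_pos ⌊α * (d : ℝ)⌋₊ with h | h
    · rw [h] at hd3; simp at hd3
    · exact h
  have hkd : ⌊α * d⌋₊ < d := by
    rw [div_lt_one hd] at hd4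
    exact_mod_cast hd4
  have hmain := exp_negRelEntropy_le hk0 hkd h0 h1
  have hB := binomialMass_pos hkd.le h0 h1
  calc Real.exp (d * (negRelEntropy p α - η))
      = Real.exp (d * (negRelEntropy p α - η / 2)) * Real.exp (-(η / 2)) ^ d := by
        rw [← Real.exp_nat_mul, ← Real.exp_add]; congr 1; ring
    _ ≤ Real.exp (d * negRelEntropy p (⌊α * d⌋₊ / d)) * Real.exp (-(η / 2)) ^ d := by
        gcongr
        exact hd1.le
    _ ≤ (d + 1) * binomialMass d ⌊α * d⌋₊ p * Real.exp (-(η / 2)) ^ d := by gcongr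
    _ = binomialMass d ⌊α * d⌋₊ p * ((d + 1) * Real.exp (-(η / 2)) ^ d) := by ring
    _ ≤ binomialMass d ⌊α * d⌋₊ p * 1 := by gcongr
    _ = _ := mul_one _

/-! ### The exponent -/

/-- The exponent of the first appearance of `s`-cliques. -/
noncomputable def uniformExponent (s : ℕ) (p α : ℝ) : ℝ :=
  cliqueExponent s p + negRelEntropy p α

theorem cliqueExponent_eq {p : ℝ} (h0 : 0 < p) (h1 : p < 1) {s : ℕ} (hs : 1 ≤ s) :
    cliqueExponent s p = -(Real.log (columnWeight s p) / s) := by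
  have hs0 : (s : ℝ) ≠ 0 := by positivity
  have ha : 0 < (1 + p) / 2 := by positivity
  have hq := columnWeight_pos h0.le h1.le s
  have e : columnWeight s p = ((1 + p) / 2) ^ s * (2 - (2 * p / (1 + p)) ^ s) := by
    have : (2 * p / (1 + p)) ^ s = p ^ s / ((1 + p) / 2) ^ s := by
      rw [← div_pow]; congr 1; field_simp
    rw [this, columnWeight]
    field_simp
  have hpos : 0 < 2 - (2 * p / (1 + p)) ^ s := by
    rw [e] at hq
    exact (pos_iff_pos_of_mul_pos hq).1 (by positivity)
  rw [cliqueExponent, e, Real.log_mul (by positivity) hpos.ne', Real.log_pow,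
    show 2 / (1 + p) = ((1 + p) / 2)⁻¹ by rw [inv_div], Real.log_inv]
  field_simp
  ring

theorem exp_pow_eq_columnWeight {p α : ℝ} (h0 : 0 < p) (h1 : p < 1) {s : ℕ} (hs : 1 ≤ s) :
    Real.exp (negRelEntropy p α - uniformExponent s p α) ^ s = columnWeight s p := by
  have hs0 : (s : ℝ) ≠ 0 := by positivity
  rw [← Real.exp_nat_mul, uniformExponent, cliqueExponent_eq h0 h1 hs]
  rw [show (s : ℝ) * (negRelEntropy p α - (-(Real.log (columnWeight s p) / s)
    + negRelEntropy p α)) = Real.log (columnWeight s p) by field_simp; ring]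
  exact Real.exp_log (columnWeight_pos h0.le h1.le s)

/-- If `alphaS s p = α`, the lower bound for the clique probability has the same exponential
rate as the upper bound obtained from the binomial model with parameter `p`. -/
theorem eventually_exp_le_cliqueProb {α : ℝ} (hα : α ∈ Set.Ioo (0 : ℝ) 1) {p : ℝ} (h0 : 0 < p)
    (h1 : p < 1) {s : ℕ} (hs : 1 ≤ s) (hpα : alphaS s p = α) {η : ℝ} (hη : 0 < η) :
    ∀ᶠ d : ℕ in atTop, Real.exp (-(d * s * (uniformExponent s p α + η)))
      ≤ cliqueProb d ⌊α * d⌋₊ s := by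
  have hα0 := hα.1
  have hα1 : 0 < 1 - α := by linarith [hα.2]
  have hp : 0 < 1 - p := by linarith
  have hs0 : (0 : ℝ) < s := by positivity
  set T := uniformExponent s p α with hT
  -- the minimiser of the exponential Markov bound for a binomial variable to exceed `α d`
  set l := α * (1 - p) / (p * (1 - α)) with hl
  have hl0 : 0 < l := by positivity
  have hl1 : 1 ≤ l := by
    rw [hl, one_le_div (by positivity)]
    have := le_alphaS h0.le h1.le hs
    rw [hpα] at this
    nlinarith
  have hden : 1 - p + p * l = (1 - p) / (1 - α) := by
    rw [hl]; field_simp; ring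
  have hval : columnWeight s p * (l ^ (α - (p - p)) / (1 - p + p * l)) ^ s
      = Real.exp (-(s * T)) := by
    have hlog : l ^ α / (1 - p + p * l) = Real.exp (-negRelEntropy p α) := by
      rw [hden, Real.rpow_def_of_pos hl0, ← Real.exp_log (div_pos hp hα1), ← Real.exp_sub, hl,
        negRelEntropy, Real.log_div (by positivity) (by positivity), Real.log_mul hα0.ne' hp.ne',
        Real.log_mul h0.ne' hα1.ne', Real.log_div hp.ne' hα1.ne', Real.log_div h0.ne' hα0.ne']
      congr 1
      ring
    rw [sub_self, sub_zero, hlog, ← exp_pow_eq_columnWeight (α := α) h0 h1 hs, ← mul_pow,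
      ← Real.exp_add, ← Real.exp_nat_mul]
    congr 1
    ring
  -- perturb `p` to the left, and `α` accordingly
  set g : ℝ → ℝ := fun x =>
    columnWeight s x * (l ^ (alphaS s x - (p - x)) / (1 - x + x * l)) ^ s with hg
  have hcα : ContinuousAt (alphaS s) p :=
    (alphaS_continuousOn s).continuousAt (Icc_mem_nhds h0 h1)
  have hcont : ContinuousAt g p := by
    have hq : ContinuousAt (columnWeight s) p := by unfold columnWeight; fun_prop
    have he : ContinuousAt (fun x => l ^ (alphaS s x - (p - x))) p :=
      ContinuousAt.rpow continuousAt_const (hcα.sub (by fun_prop)) (Or.inl hl0.ne')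
    refine hq.mul ((he.div (by fun_prop) ?_).pow s)
    rw [hden]
    positivity
  have hgp : g p = Real.exp (-(s * T)) := by rw [← hval]; simp only [hg, hpα]
  have hlt : Real.exp (-(s * (T + η / 2))) < g p := by
    rw [hgp, Real.exp_lt_exp]
    nlinarith
  have hev : ∀ᶠ x in 𝓝[<] p, (Real.exp (-(s * (T + η / 2))) < g x ∧ 0 < x) ∧ x < p :=
    (((hcont.tendsto.eventually (lt_mem_nhds hlt)).and
      (lt_mem_nhds h0)).filter_mono nhdsWithin_le_nhds).and self_mem_nhdsWithin
  obtain ⟨x, ⟨hgx, hx0⟩, hxp⟩ := hev.exists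
  have hx1 : x < 1 := hxp.trans h1
  have hxα : alphaS s x < α := by
    rw [← hpα]
    exact alphaS_strictMonoOn hs ⟨hx0.le, hx1⟩ ⟨h0.le, h1⟩ hxp
  have hmain := eventually_le_cliqueProb (Set.Ioo_subset_Icc_self hα) hs (β := alphaS s x - (p - x))
    hx0 hx1 (by linarith) hxα hl1
  have hhalf : Tendsto (fun d : ℕ => Real.exp (-(s * (η / 2))) ^ d) atTop (𝓝 0) :=
    tendsto_pow_atTop_nhds_zero_of_lt_one (Real.exp_pos _).le
      (Real.exp_lt_one_iff.2 (by nlinarith))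
  filter_upwards [hmain, hhalf.eventually (gt_mem_nhds (show (0 : ℝ) < 1 / 2 by norm_num))]
    with d hd1 hd2
  refine le_trans ?_ hd1
  calc Real.exp (-(d * s * (T + η)))
      = Real.exp (-(s * (η / 2))) ^ d * Real.exp (-(s * (T + η / 2))) ^ d := by
        rw [← Real.exp_nat_mul, ← Real.exp_nat_mul, ← Real.exp_add]; congr 1; ring
    _ ≤ 1 / 2 * g x ^ d := by gcongr

theorem uniformExponent_nonneg {α : ℝ} (hα : α ∈ Set.Ioo (0 : ℝ) 1) {p : ℝ} (h0 : 0 < p)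
    (h1 : p < 1) {s : ℕ} (hs : 1 ≤ s) (hpα : alphaS s p = α) : 0 ≤ uniformExponent s p α := by
  refine le_of_forall_pos_le_add fun η hη => ?_
  obtain ⟨d, hd, hd0⟩ := ((eventually_exp_le_cliqueProb hα h0 h1 hs hpα hη).and
    (eventually_gt_atTop 0)).exists
  have h := hd.trans (cliqueProb_le_one (floor_mul_le (Set.Ioo_subset_Icc_self hα) d) s)
  rw [Real.exp_le_one_iff] at h
  have : (0 : ℝ) < d * s := by positivity
  nlinarith

/-! ### The hitting time -/

theorem containsClique_iff {d : ℕ} (f : ℕ → Subcube d) (s n : ℕ) :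
    ContainsClique s n (subcubeGraph f n)
      ↔ ∃ S ⊆ Finset.range n, S.card = s ∧ f ∈ cliqueEvent d S := by
  have hadj : ∀ u v : Fin n, (subcubeGraph f n).Adj u v
      ↔ u ≠ v ∧ ∀ i, SymCompat (f u i) (f v i) := fun u v =>
    and_congr_right fun _ => points_inter_nonempty_iff _ _
  have hrefl : ∀ a : Option Bool, SymCompat a a := fun a => Or.inr (Or.inr rfl)
  constructor
  · rintro ⟨S, hS⟩
    refine ⟨S.map Fin.valEmbedding, fun x hx => ?_, by rw [Finset.card_map, hS.card_eq],
      fun i u hu v hv => ?_⟩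
    · obtain ⟨y, -, rfl⟩ := Finset.mem_map.1 hx
      exact Finset.mem_range.2 y.is_lt
    · obtain ⟨u, hu', rfl⟩ := Finset.mem_map.1 hu
      obtain ⟨v, hv', rfl⟩ := Finset.mem_map.1 hv
      by_cases huv : u = v
      · subst huv
        exact hrefl _
      · exact ((hadj u v).1 (hS.isClique hu' hv' huv)).2 i
  · rintro ⟨S, hSn, hcard, hS⟩
    refine ⟨S.attachFin fun x hx => Finset.mem_range.1 (hSn hx), ?_, ?_⟩
    · intro u hu v hv huv
      rw [Finset.mem_coe, Finset.mem_attachFin] at hu hv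
      exact (hadj u v).2 ⟨huv, fun i => hS i u hu v hv⟩
    · rw [Finset.card_attachFin, hcard]

/-- The first moment bound: cliques among the first `n` vertices are unlikely if `n ^ s` times the
clique probability is small. -/
theorem uniformModel_exists_clique_le {d k : ℕ} (hk : k ≤ d) (s n : ℕ) :
    (uniformModel hk).real {f | ∃ S ⊆ Finset.range n, S.card = s ∧ f ∈ cliqueEvent d S}
      ≤ (n : ℝ) ^ s * cliqueProb d k s := by
  have e : {f | ∃ S ⊆ Finset.range n, S.card = s ∧ f ∈ cliqueEvent d S}
      = ⋃ S ∈ Finset.powersetCard s (Finset.range n), cliqueEvent d S := by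
    ext f
    simp [Finset.mem_powersetCard, and_assoc]
  rw [e]
  refine (measureReal_biUnion_finset_le _ _).trans ?_
  calc ∑ S ∈ Finset.powersetCard s (Finset.range n), (uniformModel hk).real (cliqueEvent d S)
      = ∑ S ∈ Finset.powersetCard s (Finset.range n), cliqueProb d k s := by
        refine Finset.sum_congr rfl fun S hS => ?_
        rw [uniformModel_cliqueEvent, (Finset.mem_powersetCard.1 hS).2]
    _ = (n.choose s : ℝ) * cliqueProb d k s := by simp
    _ ≤ _ := by
        refine mul_le_mul_of_nonneg_right ?_ (cliqueProb_nonneg _ _ _)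
        exact_mod_cast Nat.choose_le_pow n s

theorem one_add_pow_le {u : ℝ} (h0 : 0 ≤ u) (h1 : u ≤ 1) (s : ℕ) :
    (1 + u) ^ s - 1 ≤ 2 ^ s * u := by
  have : (1 + u) ^ s ≤ 1 + (2 ^ s - 1) * u := by
    induction s with
    | zero => simp
    | succ s ih =>
      have h2 : (1 : ℝ) ≤ 2 ^ s := one_le_pow₀ (by norm_num)
      calc (1 + u) ^ (s + 1) ≤ (1 + (2 ^ s - 1) * u) * (1 + u) := by
            rw [pow_succ]
            exact mul_le_mul_of_nonneg_right ih (by linarith)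
        _ ≤ 1 + (2 ^ (s + 1) - 1) * u := by
            rw [pow_succ]
            nlinarith [mul_nonneg (mul_nonneg (sub_nonneg.2 h2) h0) (sub_nonneg.2 h1)]
  linarith

/-- Outside of the first and second moment exceptional events, the hitting time lies between the
numbers of vertices for which these events are formulated. -/
theorem abs_log_hittingTime_sub_le {d s m n : ℕ} (hd : 0 < d) {f : ℕ → Subcube d}
    {T ε : ℝ} (hn : Real.exp (d * (T - ε)) < n + 1)
    (hm : (s * m : ℕ) ≤ Real.exp (d * (T + ε)))
    (h1 : ¬ ∃ S ⊆ Finset.range n, S.card = s ∧ f ∈ cliqueEvent d S)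
    (h2 : ¬ ∀ v : Fin s → Fin m, f ∉ cliqueEvent d (tupleSet v)) :
    |Real.log (hittingTime (ContainsClique s) f) / d - T| ≤ ε := by
  push Not at h2
  obtain ⟨v, hv⟩ := h2
  have hdR : (0 : ℝ) < d := by exact_mod_cast hd
  have hmem : s * m ∈ {n | ContainsClique s n (subcubeGraph f n)} :=
    (containsClique_iff f s _).2 ⟨_, tupleSet_subset v, tupleSet_card v, hv⟩
  have hle : hittingTime (ContainsClique s) f ≤ s * m := Nat.sInf_le hmem
  have hN : ContainsClique s _ (subcubeGraph f (hittingTime (ContainsClique s) f)) :=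
    Nat.sInf_mem ⟨_, hmem⟩
  set N := hittingTime (ContainsClique s) f
  have hlt : n < N := by
    by_contra h
    obtain ⟨S, hS, hS'⟩ := (containsClique_iff f s N).1 hN
    exact h1 ⟨S, hS.trans (Finset.range_subset_range.2 (not_lt.1 h)), hS'⟩
  have hNR : (n : ℝ) + 1 ≤ N := by exact_mod_cast hlt
  have hNle : (N : ℝ) ≤ (s * m : ℕ) := by exact_mod_cast hle
  have hN0 : (0 : ℝ) < N := by
    have : (0 : ℝ) ≤ n := Nat.cast_nonneg n
    linarith
  have hlow : d * (T - ε) ≤ Real.log N := (Real.le_log_iff_exp_le hN0).2 (by linarith)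
  have hup : Real.log N ≤ d * (T + ε) := (Real.log_le_iff_le_exp hN0).2 (by linarith)
  rw [abs_le]
  constructor
  · rw [le_sub_iff_add_le, le_div_iff₀ hdR]
    linarith
  · rw [sub_le_iff_le_add, div_le_iff₀ hdR]
    linarith

/-- The convergence in probability, with an exponential rate. -/
theorem eventually_uniformModel_le {α : ℝ} (hα : α ∈ Set.Ioo (0 : ℝ) 1) {p : ℝ} (h0 : 0 < p)
    (h1 : p < 1) {s : ℕ} (hs : 1 ≤ s) (hpα : alphaS s p = α) {ε : ℝ} (hε : 0 < ε) :
    ∀ᶠ d : ℕ in atTop,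
      uniformModel (floor_mul_le (Set.Ioo_subset_Icc_self hα) d)
        {f | ε ≤ |Real.log (hittingTime (ContainsClique s) f) / d - uniformExponent s p α|}
      ≤ ENNReal.ofReal ((1 + 2 ^ s * (2 * s)) * Real.exp (-(ε / 8)) ^ d) := by
  set T := uniformExponent s p α with hT
  have hT0 : 0 ≤ T := uniformExponent_nonneg hα h0 h1 hs hpα
  have hs1 : (1 : ℝ) ≤ s := by exact_mod_cast hs
  have hs0 : (0 : ℝ) < s := by linarith
  -- `η` is small enough that the error factor `exp (4 s η d)` of the second moment bound is harmless
  set η := ε / (8 * (4 * s + 1)) with hη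
  have hη0 : 0 < η := by positivity
  have hηε : (4 * s + 1) * η = ε / 8 := by rw [hη]; field_simp
  have hη8 : η ≤ ε / 8 := by nlinarith
  have hbig : Tendsto (fun d : ℕ => Real.exp (-(ε / 8)) ^ d * (2 * s)) atTop (𝓝 0) := by
    simpa using (tendsto_pow_atTop_nhds_zero_of_lt_one (Real.exp_pos _).le
      (Real.exp_lt_one_iff.2 (show -(ε / 8) < 0 by linarith))).mul_const (2 * (s : ℝ))
  filter_upwards [eventually_exp_le_binomialMass hα h0 h1 hη0,
    eventually_exp_le_cliqueProb hα h0 h1 hs hpα hη0, hbig.eventually (gt_mem_nhds one_pos),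
    eventually_gt_atTop 0] with d hB hF hd2 hd0
  have hdR : (0 : ℝ) < d := by exact_mod_cast hd0
  set k := ⌊α * d⌋₊ with hk
  have hkd : k ≤ d := floor_mul_le (Set.Ioo_subset_Icc_self hα) d
  set r := Real.exp (negRelEntropy p α - T) with hr
  have hrs : r ^ s = columnWeight s p := exp_pow_eq_columnWeight h0 h1 hs
  have hr0 : 0 < r := Real.exp_pos _
  set B := binomialMass d k p with hBdef
  have hB0 : 0 < B := binomialMass_pos hkd h0 h1
  set F := cliqueProb d k s with hFdef
  have hF0 : 0 < F := (Real.exp_pos _).trans_le hF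
  -- upper bound for the normalised binomial clique weight
  have hDup : r ^ d / B ≤ Real.exp (d * (η - T)) := by
    rw [div_le_iff₀ hB0]
    calc r ^ d = Real.exp (d * (η - T)) * Real.exp (d * (negRelEntropy p α - η)) := by
          rw [hr, ← Real.exp_nat_mul, ← Real.exp_add]; congr 1; ring
      _ ≤ _ := by gcongr
  have hFD : F ≤ (r ^ d / B) ^ s := by
    have := cliqueProb_le hkd h0 h1 hs
    rwa [← hrs, ← pow_mul, mul_comm s, pow_mul, ← div_pow] at this
  have hDlow : Real.exp (-(d * (T + η))) ≤ r ^ d / B := by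
    refine (pow_le_pow_iff_left₀ (Real.exp_pos _).le (by positivity)
      (show s ≠ 0 by omega)).1 (le_trans (le_of_eq ?_) (hF.trans hFD))
    rw [← Real.exp_nat_mul]
    congr 1
    ring
  -- the numbers of vertices for the first and the second moment bound
  set n := ⌊Real.exp (d * (T - ε / 2))⌋₊ with hn
  set m := ⌊Real.exp (d * (T + ε / 2)) / s⌋₊ with hm
  have hx1 : 1 ≤ Real.exp (d * (T + ε / 2)) / s := by
    rw [one_le_div hs0]
    have e1 : Real.exp (-(ε / 8)) ^ d * Real.exp (d * (ε / 8)) = 1 := by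
      rw [← Real.exp_nat_mul, ← Real.exp_add, Real.exp_eq_one_iff]; ring
    have e2 : Real.exp (d * (ε / 8)) ≤ Real.exp (d * (T + ε / 2)) :=
      Real.exp_le_exp.2 (mul_le_mul_of_nonneg_left (by linarith) hdR.le)
    have e3 : 0 < Real.exp (d * (ε / 8)) := Real.exp_pos _
    nlinarith
  have hm0 : 0 < m := Nat.floor_pos.2 hx1
  have hmR : (0 : ℝ) < m := by exact_mod_cast hm0
  have hmlow : Real.exp (d * (T + ε / 2)) / (2 * s) ≤ m := by
    have h3 := Nat.lt_floor_add_one (Real.exp (d * (T + ε / 2)) / s)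
    have h4 : (1 : ℝ) ≤ m := by exact_mod_cast hm0
    have h5 : Real.exp (d * (T + ε / 2)) / (2 * s) = Real.exp (d * (T + ε / 2)) / s / 2 := by
      field_simp
    rw [h5]
    linarith
  have hsm : ((s * m : ℕ) : ℝ) ≤ Real.exp (d * (T + ε / 2)) := by
    have := Nat.floor_le (show 0 ≤ Real.exp (d * (T + ε / 2)) / s by positivity)
    rw [← hm, le_div_iff₀ hs0] at this
    push_cast
    linarith
  set A₁ : Set (ℕ → Subcube d) := {f | ∃ S ⊆ Finset.range n, S.card = s ∧ f ∈ cliqueEvent d S}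
  set A₂ : Set (ℕ → Subcube d) := {f | ∀ v : Fin s → Fin m, f ∉ cliqueEvent d (tupleSet v)}
  have hsub : {f : ℕ → Subcube d |
      ε ≤ |Real.log (hittingTime (ContainsClique s) f) / d - T|} ⊆ A₁ ∪ A₂ := by
    intro f hf
    by_contra hno
    rw [Set.mem_union, not_or] at hno
    have := abs_log_hittingTime_sub_le hd0 (Nat.lt_floor_add_one _) hsm hno.1 hno.2
    have hf' : ε ≤ |Real.log (hittingTime (ContainsClique s) f) / d - T| := hf
    linarith
  have hA₁ : (uniformModel hkd).real A₁ ≤ Real.exp (-(ε / 8)) ^ d := by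
    have hnle : (n : ℝ) ≤ Real.exp (d * (T - ε / 2)) := Nat.floor_le (Real.exp_pos _).le
    calc (uniformModel hkd).real A₁ ≤ (n : ℝ) ^ s * F := uniformModel_exists_clique_le hkd s n
      _ ≤ Real.exp (d * (T - ε / 2)) ^ s * Real.exp (d * (η - T)) ^ s := by
          gcongr
          exact hFD.trans (pow_le_pow_left₀ (by positivity) hDup s)
      _ = Real.exp (-(s * (d * (ε / 2 - η)))) := by
          rw [← Real.exp_nat_mul, ← Real.exp_nat_mul, ← Real.exp_add]; congr 1; ring
      _ ≤ Real.exp (-(1 * (d * (ε / 8)))) := by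
          rw [Real.exp_le_exp, neg_le_neg_iff]
          have h6 : (d : ℝ) * (ε / 8) ≤ d * (ε / 2 - η) :=
            mul_le_mul_of_nonneg_left (by linarith) hdR.le
          exact mul_le_mul hs1 h6 (by positivity) hs0.le
      _ = _ := by rw [← Real.exp_nat_mul]; congr 1; ring
  have hA₂ : (uniformModel hkd).real A₂ ≤ 2 ^ s * (2 * s) * Real.exp (-(ε / 8)) ^ d := by
    have hmain := uniformModel_no_clique_le hkd h0 h1 hs hr0 hrs hF0 hm0
    have hu : B / r ^ d / m ≤ 2 * s * Real.exp (d * (η - ε / 2)) := by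
      have h7 : B / r ^ d ≤ Real.exp (d * (T + η)) := by
        rw [← inv_div, inv_le_comm₀ (by positivity) (Real.exp_pos _), ← Real.exp_neg]
        exact hDlow
      rw [div_le_iff₀ hmR]
      calc B / r ^ d ≤ Real.exp (d * (T + η)) := h7
        _ = 2 * s * Real.exp (d * (η - ε / 2)) * (Real.exp (d * (T + ε / 2)) / (2 * s)) := by
            rw [show (d : ℝ) * (T + η) = d * (η - ε / 2) + d * (T + ε / 2) by ring, Real.exp_add]
            field_simp
        _ ≤ _ := by gcongr
    have hu1 : 2 * s * Real.exp (d * (η - ε / 2)) ≤ 1 := by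
      have : Real.exp (d * (η - ε / 2)) ≤ Real.exp (-(ε / 8)) ^ d := by
        rw [← Real.exp_nat_mul, Real.exp_le_exp]
        exact mul_le_mul_of_nonneg_left (by linarith) hdR.le
      nlinarith
    have hratio : ((r ^ d / B) ^ s / F) ^ 2 ≤ Real.exp (d * (4 * s * η)) := by
      have h8 : (r ^ d / B) ^ s / F ≤ Real.exp (d * (2 * s * η)) := by
        rw [div_le_iff₀ hF0]
        calc (r ^ d / B) ^ s ≤ Real.exp (d * (η - T)) ^ s :=
              pow_le_pow_left₀ (by positivity) hDup s
          _ = Real.exp (d * (2 * s * η)) * Real.exp (-(d * s * (T + η))) := by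
              rw [← Real.exp_nat_mul, ← Real.exp_add]; congr 1; ring
          _ ≤ _ := by gcongr
      calc ((r ^ d / B) ^ s / F) ^ 2 ≤ Real.exp (d * (2 * s * η)) ^ 2 :=
            pow_le_pow_left₀ (by positivity) h8 2
        _ = _ := by rw [← Real.exp_nat_mul]; congr 1; push_cast; ring
    have hu0 : 0 ≤ B / r ^ d / m := by positivity
    calc (uniformModel hkd).real A₂ ≤ _ := hmain
      _ ≤ Real.exp (d * (4 * s * η)) * (2 ^ s * (2 * s * Real.exp (d * (η - ε / 2)))) := by
          have h9 := one_add_pow_le hu0 (hu.trans hu1) s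
          have h10 : (0 : ℝ) ≤ (1 + B / r ^ d / m) ^ s - 1 :=
            sub_nonneg.2 (one_le_pow₀ (by linarith))
          exact mul_le_mul hratio (h9.trans (by gcongr)) h10 (Real.exp_pos _).le
      _ = 2 ^ s * (2 * s) * Real.exp (d * ((4 * s + 1) * η - ε / 2)) := by
          rw [show (d : ℝ) * ((4 * s + 1) * η - ε / 2) = d * (4 * s * η) + d * (η - ε / 2) by ring,
            Real.exp_add]
          ring
      _ ≤ _ := by
          refine mul_le_mul_of_nonneg_left ?_ (by positivity)
          rw [hηε, ← Real.exp_nat_mul, Real.exp_le_exp]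
          exact mul_le_mul_of_nonneg_left (by linarith) hdR.le
  calc uniformModel hkd _ ≤ uniformModel hkd (A₁ ∪ A₂) := measure_mono hsub
    _ = ENNReal.ofReal ((uniformModel hkd).real (A₁ ∪ A₂)) := (ofReal_measureReal).symm
    _ ≤ _ := by
        refine ENNReal.ofReal_le_ofReal ((measureReal_union_le _ _).trans ?_)
        rw [add_mul, one_mul]
        exact add_le_add hA₁ hA₂

/-! ### The threshold -/

theorem mainTheorem5 (α : ℝ) (hα : α ∈ Set.Ioo (0 : ℝ) 1) (s : ℕ) (hs : 1 ≤ s) :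
    Set.BijOn (alphaS s) (Set.Ioo 0 1) (Set.Ioo 0 1) ∧
      ∀ p ∈ Set.Ioo (0 : ℝ) 1, alphaS s p = α →
        IsUniformThreshold (ContainsClique s) (Set.Ioo_subset_Icc_self hα)
          (cliqueExponent s p + α * Real.log (p / α)
            + (1 - α) * Real.log ((1 - p) / (1 - α))) := by
  refine ⟨alphaS_bijOn hs, fun p hp hpα => ?_⟩
  have e : cliqueExponent s p + α * Real.log (p / α) + (1 - α) * Real.log ((1 - p) / (1 - α))
      = uniformExponent s p α := by
    rw [uniformExponent, negRelEntropy, add_assoc]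
  rw [e]
  refine ⟨uniformExponent_nonneg hα hp.1 hp.2 hs hpα, fun ε hε => ?_⟩
  have hlim : Tendsto (fun d : ℕ => ENNReal.ofReal
      ((1 + 2 ^ s * (2 * s)) * Real.exp (-(ε / 8)) ^ d)) atTop (𝓝 0) := by
    have := (tendsto_pow_atTop_nhds_zero_of_lt_one (Real.exp_pos _).le
      (Real.exp_lt_one_iff.2 (show -(ε / 8) < 0 by linarith))).const_mul
        (1 + 2 ^ s * (2 * (s : ℝ)))
    rw [mul_zero] at this
    simpa using ENNReal.tendsto_ofReal this
  exact tendsto_of_tendsto_of_tendsto_of_le_of_le' tendsto_const_nhds hlim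
    (Eventually.of_forall fun _ => zero_le) (eventually_uniformModel_le hα hp.1 hp.2 hs hpα hε)
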